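/- A *modular ortholattice* (MOL) is a bounded modular lattice with a unary operation $'$ such that $x+x'=1$, $x\cdot x'=0$, $x''=x$, and $x\le y$ implies $y'\le x'$ (joins are written $+$, meets $\cdot$). A *3-frame* in $L$ consists of elements $a_i,a_{ij}$ ($1\le i\neq j\le 3$) such that for all distinct $j,k,l$ $$a_j\sum_{i\ne j}a_i=\prod_i a_i=a_ja_{jk},\qquad a_j+a_{jk}=a_j+a_k,\qquad a_{jl}=a_{lj}=(a_j+a_l)(a_{jk}+a_{kl});$$ it is *orthogonal* if $a_j\le a_k'$ for all $j\ne k$. It *generates* $L$ if $L$ is its only sub-MOL (subset containing $0,1$ and closed under $+,\cdot,{}'$) containing the frame. The *height* of a lattice is the minimal length of its maximal chains, the length of a chain being its cardinality with one element deleted. An MOL is *subdirectly irreducible* if it has a least congruence among those different from equality. **Corollary.** There is a subdirectly irreducible MOL of infinite height that is generated by an orthogonal 3-frame. It is obtained as a sublattice of an ultraproduct, as follows. For $n\ge 1$ let $e_{(i,t)}$ ($1\le i\le 3$, $1\le t\le n$) be the standard basis of $\mathbb Q^{3n}$, and let the canonical 3-frame in the lattice of subspaces of $\mathbb Q^{3n}$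 consist of $E_i=\mathrm{span}\{e_{(i,t)}\mid t\le n\}$ and $E_{ij}=\mathrm{span}\{e_{(i,t)}-e_{(j,t)}\mid t\le n\}$. There are positive definite symmetric bilinear forms $\Phi_k$ on $\mathbb Q^{3\cdot 2^k}$ ($k\ge 0$) such that, for each $k$, the canonical 3-frame of $\mathbb Q^{3\cdot 2^k}$ is an orthogonal 3-frame generating the MOL $L_k$ of all subspaces of $\mathbb Q^{3\cdot 2^k}$ with the orthocomplementation induced by $\Phi_k$, and such that for every non-principal ultrafilter $U$ on $\mathbb N$ the ultraproduct $\prod_k L_k/U$ has a sub-MOL $S$ that is subdirectly irreducible, of infinite height, and generated by an orthogonal 3-frame, namely by the elements of the ultraproduct represented by the families of canonical frames. -/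

import Mathlib

/-- A modular ortholattice (MOL): a bounded modular lattice with an orthocomplementation. -/
class ModularOrtholattice (L : Type*) extends Lattice L, BoundedOrder L, Compl L where
  sup_compl : ∀ x : L, x ⊔ xᶜ = ⊤
  inf_compl : ∀ x : L, x ⊓ xᶜ = ⊥
  compl_compl' : ∀ x : L, xᶜᶜ = x
  compl_anti : ∀ x y : L, x ≤ y → yᶜ ≤ xᶜ
  sup_inf_le : ∀ x y z : L, x ≤ z → (x ⊔ y) ⊓ z ≤ x ⊔ y ⊓ z

instance ModularOrtholattice.isModularLattice (L : Type*) [ModularOrtholattice L] :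
    IsModularLattice L where
  sup_inf_le_assoc_of_le {x} y {z} h := ModularOrtholattice.sup_inf_le x y z h

/-- The height of a lattice: the minimal length of maximal chains, where the length of a chain is
its cardinality with one element deleted. -/
noncomputable def latticeHeight (L : Type*) [Lattice L] : ℕ∞ :=
  ⨅ c : {c : Set L // IsMaxChain (· ≤ ·) c}, (c.1.encard - 1)

/-- Congruence relations of a modular ortholattice. -/
structure MOLCon (L : Type*) [ModularOrtholattice L] extends LatticeCon L where
  compl : ∀ {x y : L}, r x y → r xᶜ yᶜ

/-- A congruence is nontrivial if it is not the equality relation. -/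
def MOLCon.IsNontrivial {L : Type*} [ModularOrtholattice L] (θ : MOLCon L) : Prop :=
  ∃ x y : L, x ≠ y ∧ θ.r x y

/-- Subdirect irreducibility: there is a least nontrivial congruence. -/
def IsSubdirectlyIrreducibleMOL (L : Type*) [ModularOrtholattice L] : Prop :=
  ∃ μ : MOLCon L, μ.IsNontrivial ∧
    ∀ θ : MOLCon L, θ.IsNontrivial → ∀ x y : L, μ.r x y → θ.r x y

/-- Subalgebras of a modular ortholattice. -/
structure SubMOL (L : Type*) [ModularOrtholattice L] where
  carrier : Set L
  bot_mem : ⊥ ∈ carrier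
  top_mem : ⊤ ∈ carrier
  sup_mem : ∀ {x y : L}, x ∈ carrier → y ∈ carrier → x ⊔ y ∈ carrier
  inf_mem : ∀ {x y : L}, x ∈ carrier → y ∈ carrier → x ⊓ y ∈ carrier
  compl_mem : ∀ {x : L}, x ∈ carrier → xᶜ ∈ carrier

namespace SubMOL

/-- The underlying type of a subalgebra. -/
abbrev Elem {L : Type*} [ModularOrtholattice L] (S : SubMOL L) : Type _ := {x : L // x ∈ S.carrier}

/-- A subalgebra is a modular ortholattice under the restricted order and operations. -/
instance {L : Type*} [ModularOrtholattice L] (S : SubMOL L) : ModularOrtholattice S.Elem where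
  toLattice := Subtype.lattice (fun _ _ => S.sup_mem) (fun _ _ => S.inf_mem)
  top := ⟨⊤, S.top_mem⟩
  bot := ⟨⊥, S.bot_mem⟩
  le_top _ := Subtype.mk_le_mk.2 le_top
  bot_le _ := Subtype.mk_le_mk.2 bot_le
  compl x := ⟨(x.1)ᶜ, S.compl_mem x.2⟩
  sup_compl x := Subtype.ext (ModularOrtholattice.sup_compl x.1)
  inf_compl x := Subtype.ext (ModularOrtholattice.inf_compl x.1)
  compl_compl' x := Subtype.ext (ModularOrtholattice.compl_compl' x.1)
  compl_anti x y h := ModularOrtholattice.compl_anti x.1 y.1 h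
  sup_inf_le x y z h := ModularOrtholattice.sup_inf_le x.1 y.1 z.1 h

/-- The subalgebra generated by a set: the intersection of all subalgebras containing it. -/
def closure {L : Type*} [ModularOrtholattice L] (s : Set L) : SubMOL L where
  carrier := {x | ∀ T : SubMOL L, s ⊆ T.carrier → x ∈ T.carrier}
  bot_mem := fun T _ => T.bot_mem
  top_mem := fun T _ => T.top_mem
  sup_mem hx hy T hT := T.sup_mem (hx T hT) (hy T hT)
  inf_mem hx hy T hT := T.inf_mem (hx T hT) (hy T hT)
  compl_mem hx T hT := T.compl_mem (hx T hT)

end SubMOL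

/-- A list of elements `a_i` and `a_ij` (`i ≠ j`) of `L`. The values `ax i i` play no role. -/
structure FrameData (n : ℕ) (L : Type*) where
  pt : Fin n → L
  ax : Fin n → Fin n → L

namespace FrameData

variable {n : ℕ} {L : Type*}

/-- Von Neumann's conditions for an `n`-frame. -/
def IsFrame [ModularOrtholattice L] (a : FrameData n L) : Prop :=
  ∀ j k l : Fin n, j ≠ k → k ≠ l → j ≠ l →
    a.pt j ⊓ (Finset.univ.erase j).sup a.pt = Finset.univ.inf a.pt ∧
    a.pt j ⊓ a.ax j k = Finset.univ.inf a.pt ∧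
    a.pt j ⊔ a.ax j k = a.pt j ⊔ a.pt k ∧
    a.ax j l = a.ax l j ∧
    a.ax j l = (a.pt j ⊔ a.pt l) ⊓ (a.ax j k ⊔ a.ax k l)

/-- The points of the frame are pairwise orthogonal. -/
def IsOrthogonal [ModularOrtholattice L] (a : FrameData n L) : Prop :=
  ∀ j k : Fin n, j ≠ k → a.pt j ≤ (a.pt k)ᶜ

/-- The set of elements occurring in the frame. -/
def elems (a : FrameData n L) : Set L :=
  {x | (∃ i, x = a.pt i) ∨ ∃ i j, i ≠ j ∧ x = a.ax i j}

/-- `L` is generated, as a modular ortholattice, by the frame. -/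
def Generates [ModularOrtholattice L] (a : FrameData n L) : Prop :=
  ∀ x : L, x ∈ (SubMOL.closure a.elems).carrier

/-- `L` is generated by the orthogonal `n`-frame `a`. -/
def IsGeneratingOrthogonalFrame [ModularOrtholattice L] (a : FrameData n L) : Prop :=
  a.IsFrame ∧ a.IsOrthogonal ∧ a.Generates

end FrameData

/-- Positive definite symmetric bilinear forms on the rational vector space `ℚ^ι`. -/
structure PosDefForm (ι : Type*) where
  form : LinearMap.BilinForm ℚ (ι → ℚ)
  symm : ∀ x y, form x y = form y x
  pos : ∀ x, x ≠ 0 → 0 < form x x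

/-- The lattice `𝓛(ℚ^ι)` of all linear subspaces, with the orthocomplementation induced by `Φ`. -/
def SubspaceMOL {ι : Type*} (_Φ : PosDefForm ι) : Type _ := Submodule ℚ (ι → ℚ)

theorem PosDefForm.inf_orthogonal {ι : Type*} (Φ : PosDefForm ι) (X : Submodule ℚ (ι → ℚ)) :
    X ⊓ Φ.form.orthogonal X = ⊥ := by
  rw [eq_bot_iff]
  rintro x ⟨hx, hx'⟩
  by_contra h
  exact (Φ.pos x h).ne' (hx' x hx)

theorem PosDefForm.isRefl {ι : Type*} (Φ : PosDefForm ι) : Φ.form.IsRefl := by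
  intro x y h
  rw [Φ.symm, h]

theorem PosDefForm.isCompl {ι : Type*} [Finite ι] (Φ : PosDefForm ι)
    (X : Submodule ℚ (ι → ℚ)) : IsCompl X (Φ.form.orthogonal X) :=
  (LinearMap.BilinForm.isCompl_orthogonal_iff_disjoint Φ.isRefl).2
    (disjoint_iff.2 (Φ.inf_orthogonal X))

theorem PosDefForm.orthogonal_orthogonal {ι : Type*} [Finite ι] (Φ : PosDefForm ι)
    (X : Submodule ℚ (ι → ℚ)) : Φ.form.orthogonal (Φ.form.orthogonal X) = X := by
  have h1 := LinearMap.BilinForm.le_orthogonal_orthogonal (N := X) Φ.isRefl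
  refine (eq_of_le_of_inf_le_of_sup_le (z := Φ.form.orthogonal X) h1 ?_ ?_).symm
  · rw [inf_comm, Φ.inf_orthogonal]
    exact bot_le
  · rw [(Φ.isCompl X).sup_eq_top]
    exact le_top

instance SubspaceMOL.instMOL {ι : Type*} [Finite ι] (Φ : PosDefForm ι) :
    ModularOrtholattice (SubspaceMOL Φ) where
  toLattice := inferInstanceAs (Lattice (Submodule ℚ (ι → ℚ)))
  toBoundedOrder := inferInstanceAs (BoundedOrder (Submodule ℚ (ι → ℚ)))
  compl X := Φ.form.orthogonal X
  sup_compl X := (Φ.isCompl X).sup_eq_top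
  inf_compl X := Φ.inf_orthogonal X
  compl_compl' X := Φ.orthogonal_orthogonal X
  compl_anti _ _ h := LinearMap.BilinForm.orthogonal_le h
  sup_inf_le _ _ _ h := IsModularLattice.sup_inf_le_assoc_of_le (α := Submodule ℚ (ι → ℚ)) _ h

/-- The (image of the) canonical 3-frame in `𝓛(ℚ^(3n))`: with the standard basis indexed by
`(i, t)`, `i < 3`, `t < n`, the element `E_i` is spanned by the `e_(i,t)`, and `E_ij` by
the `e_(i,t) - e_(j,t)`. -/
def canonicalFrame {n : ℕ} (Φ : PosDefForm (Fin 3 × Fin n)) : FrameData 3 (SubspaceMOL Φ) where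
  pt i := (Submodule.span ℚ (Set.range fun t : Fin n =>
    (Pi.single (i, t) 1 : Fin 3 × Fin n → ℚ)) : Submodule ℚ (Fin 3 × Fin n → ℚ))
  ax i j := (Submodule.span ℚ (Set.range fun t : Fin n =>
    (Pi.single (i, t) 1 - Pi.single (j, t) 1 : Fin 3 × Fin n → ℚ)) :
      Submodule ℚ (Fin 3 × Fin n → ℚ))

/-- The reduced product of a family of modular ortholattices modulo a filter (the ultraproduct,
if `F` is an ultrafilter) with the order and the operations induced from the factors. -/
instance Filter.Product.instMOL {κ : Type*} (F : Filter κ) (L : κ → Type*)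
    [∀ k, ModularOrtholattice (L k)] : ModularOrtholattice (F.Product L) where
  le := Quotient.lift₂ (fun x y => ∀ᶠ k in F, x k ≤ y k) fun x y x' y' hx hy => by
    refine propext (Filter.eventually_congr ?_)
    filter_upwards [hx, hy] with k h1 h2
    rw [h1, h2]
  le_refl := by
    rintro ⟨x⟩
    exact Filter.Eventually.of_forall fun k => le_refl (x k)
  le_trans := by
    rintro ⟨x⟩ ⟨y⟩ ⟨z⟩ h1 h2
    exact Filter.Eventually.mp h1 (h2.mono fun k h h' => le_trans h' h)
  le_antisymm := by
    rintro ⟨x⟩ ⟨y⟩ h1 h2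
    exact Quotient.sound (Filter.Eventually.mp h1 (h2.mono fun k h h' => le_antisymm h' h))
  sup := Quotient.map₂ (fun x y k => x k ⊔ y k) fun x x' hx y y' hy => by
    change ∀ᶠ k in F, x k ⊔ y k = x' k ⊔ y' k
    filter_upwards [hx, hy] with k h1 h2
    rw [h1, h2]
  inf := Quotient.map₂ (fun x y k => x k ⊓ y k) fun x x' hx y y' hy => by
    change ∀ᶠ k in F, x k ⊓ y k = x' k ⊓ y' k
    filter_upwards [hx, hy] with k h1 h2
    rw [h1, h2]
  le_sup_left := by
    rintro ⟨x⟩ ⟨y⟩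
    exact Filter.Eventually.of_forall fun k => (le_sup_left : x k ≤ x k ⊔ y k)
  le_sup_right := by
    rintro ⟨x⟩ ⟨y⟩
    exact Filter.Eventually.of_forall fun k => (le_sup_right : y k ≤ x k ⊔ y k)
  sup_le := by
    rintro ⟨x⟩ ⟨y⟩ ⟨z⟩ h1 h2
    exact Filter.Eventually.mp h1 (h2.mono fun k h h' => sup_le h' h)
  inf_le_left := by
    rintro ⟨x⟩ ⟨y⟩
    exact Filter.Eventually.of_forall fun k => (inf_le_left : x k ⊓ y k ≤ x k)
  inf_le_right := by
    rintro ⟨x⟩ ⟨y⟩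
    exact Filter.Eventually.of_forall fun k => (inf_le_right : x k ⊓ y k ≤ y k)
  le_inf := by
    rintro ⟨x⟩ ⟨y⟩ ⟨z⟩ h1 h2
    exact Filter.Eventually.mp h1 (h2.mono fun k h h' => le_inf h' h)
  top := Quotient.mk _ fun _ => ⊤
  bot := Quotient.mk _ fun _ => ⊥
  le_top := by
    rintro ⟨x⟩
    exact Filter.Eventually.of_forall fun k => (le_top : x k ≤ ⊤)
  bot_le := by
    rintro ⟨x⟩
    exact Filter.Eventually.of_forall fun k => (bot_le : ⊥ ≤ x k)
  compl := Quotient.map (fun x k => (x k)ᶜ) fun x x' hx => by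
    change ∀ᶠ k in F, (x k)ᶜ = (x' k)ᶜ
    filter_upwards [hx] with k h1
    rw [h1]
  sup_compl := by
    rintro ⟨x⟩
    exact Quotient.sound (Filter.Eventually.of_forall fun k => ModularOrtholattice.sup_compl (x k))
  inf_compl := by
    rintro ⟨x⟩
    exact Quotient.sound (Filter.Eventually.of_forall fun k => ModularOrtholattice.inf_compl (x k))
  compl_compl' := by
    rintro ⟨x⟩
    exact Quotient.sound
      (Filter.Eventually.of_forall fun k => ModularOrtholattice.compl_compl' (x k))
  compl_anti := by
    rintro ⟨x⟩ ⟨y⟩ h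
    exact Filter.Eventually.mono h fun k h => ModularOrtholattice.compl_anti (x k) (y k) h
  sup_inf_le := by
    rintro ⟨x⟩ ⟨y⟩ ⟨z⟩ h
    exact Filter.Eventually.mono h fun k h => ModularOrtholattice.sup_inf_le (x k) (y k) (z k) h

/-- The elements of a reduced product that correspond to a family of frames. -/
def FrameData.product {κ : Type*} (F : Filter κ) {L : κ → Type*} {n : ℕ}
    (a : ∀ k, FrameData n (L k)) : FrameData n (F.Product L) where
  pt i := Quotient.mk _ fun k => (a k).pt i
  ax i j := Quotient.mk _ fun k => (a k).ax i j

/-! Write `ℚ^(3n)` as three copies of `ℚ^n`, with Gram blocks `1`, `D` and `1 + J`: here `D` is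
diagonal with distinct positive entries and `J` is the all-ones matrix. As in von Neumann's
coordinatization, the maps whose graphs between two summands lie in a sub-MOL containing the frame
form a ring closed under inverses (`coordRing`, `inv_mem_coordRing`). Orthocomplements of axes put
`D` and `J` into it (`block_mem_coordRing`), and these already yield all matrices
(`subring_eq_top`), hence all lines and all subspaces (`IsFrameFamily.mem_of_unit`).

In the ultraproduct let `S` be generated by the frame. In factor `k` the entries of `D` are `k + 1,
…, k + 2^k`, so for large `k` they avoid the poles of any given rational function. The Gram matrix
is `diag(1, X, 1)` evaluated at `D` plus a term of rank one. Hence every element of `S` is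
represented by subspaces that agree, up to finitely many vectors whose number does not depend on
`k`, with the range of an idempotent 3×3 matrix over `ℚ(X)` evaluated at `D` (`IsSandwiched`).

Let `v` be the all-ones vector. The lines spanned by `D^j v` in a summand belong to `S`, since `D^j
J` is in the coordinate ring, and each nonzero element of `S` is non-orthogonal to one of them
(`IsSandwiched.eventually_eq_bot`, `exists_powLine_inf_compl`). So a congruence collapsing a nonzero
element collapses such a line, and then also the line of `(v, -v, -v)`, which is orthogonal to none
of them. The congruence collapsing this last line is therefore the least nontrivial one.

For the height, projecting such a line to a nonzero `z` gives a nonzero element below `z` of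
dimension at most one in almost every factor. In a finite maximal chain, the step at which bounded
dimension is lost could be refined by such an element. -/

/-! ### Graphs of endomorphisms and lattice terms for their arithmetic -/

section GraphCalculus

variable {n : ℕ}

/-- The `i`-th component of a vector of `ℚ^(3n) = (ℚ^n)^3`. -/
def comp (i : Fin 3) : (Fin 3 × Fin n → ℚ) →ₗ[ℚ] (Fin n → ℚ) :=
  LinearMap.funLeft ℚ ℚ fun t => (i, t)

/-- The inclusion of the `i`-th summand of `ℚ^(3n) = (ℚ^n)^3`. -/
def incl (i : Fin 3) : (Fin n → ℚ) →ₗ[ℚ] (Fin 3 × Fin n → ℚ) where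
  toFun y p := if p.1 = i then y p.2 else 0
  map_add' y z := by ext p; by_cases h : p.1 = i <;> simp [h]
  map_smul' c y := by ext p; by_cases h : p.1 = i <;> simp [h]

theorem comp_apply (i : Fin 3) (x : Fin 3 × Fin n → ℚ) (t : Fin n) : comp i x t = x (i, t) := rfl

@[simp] theorem comp_incl_self (i : Fin 3) (y : Fin n → ℚ) : comp i (incl i y) = y := by
  ext t; simp [comp_apply, incl]

theorem comp_incl_of_ne {i j : Fin 3} (h : i ≠ j) (y : Fin n → ℚ) : comp i (incl j y) = 0 := by
  ext t; simp [comp_apply, incl, h]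

theorem eq_of_comp {x y : Fin 3 × Fin n → ℚ} {i j l : Fin 3} (hij : i ≠ j) (hjl : j ≠ l)
    (hil : i ≠ l) (hi : comp i x = comp i y) (hj : comp j x = comp j y)
    (hl : comp l x = comp l y) : x = y := by
  have h : ∀ m : Fin 3, m = i ∨ m = j ∨ m = l := by clear hi hj hl; revert i j l; decide
  ext ⟨m, t⟩
  rcases h m with rfl | rfl | rfl
  · exact congrFun hi t
  · exact congrFun hj t
  · exact congrFun hl t

/-- The `i`-th summand of `(ℚ^n)^3`. -/
def axisSub (i : Fin 3) : Submodule ℚ (Fin 3 × Fin n → ℚ) where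
  carrier := {x | ∀ m, m ≠ i → comp m x = 0}
  zero_mem' := fun m _ => map_zero _
  add_mem' := fun hx hy m hm => by rw [map_add, hx m hm, hy m hm, add_zero]
  smul_mem' := fun c x hx m hm => by rw [map_smul, hx m hm, smul_zero]

/-- The negative of the graph of `r`, as a map from the `i`-th to the `j`-th summand. -/
def graphSub (i j : Fin 3) (r : Module.End ℚ (Fin n → ℚ)) :
    Submodule ℚ (Fin 3 × Fin n → ℚ) where
  carrier := {x | comp j x = - r (comp i x) ∧ ∀ m, m ≠ i → m ≠ j → comp m x = 0}
  zero_mem' := ⟨by simp, fun m _ _ => map_zero _⟩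
  add_mem' := fun hx hy => ⟨by rw [map_add, map_add, map_add, hx.1, hy.1, neg_add],
    fun m h h' => by rw [map_add, hx.2 m h h', hy.2 m h h', add_zero]⟩
  smul_mem' := fun c x hx => ⟨by rw [map_smul, map_smul, map_smul, hx.1, smul_neg],
    fun m h h' => by rw [map_smul, hx.2 m h h', smul_zero]⟩

/-- The image of `r` in the `i`-th summand. -/
def imageSub (i : Fin 3) (r : Module.End ℚ (Fin n → ℚ)) : Submodule ℚ (Fin 3 × Fin n → ℚ) :=
  (LinearMap.range r).map (incl i)

theorem ne_and_ne_iff {i j l : Fin 3} (hij : i ≠ j) (hjl : j ≠ l) (hil : i ≠ l)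
    (m : Fin 3) : (m ≠ i ∧ m ≠ j) ↔ m = l := by revert i j l m; decide

theorem mem_axisSub_iff {i j l : Fin 3} (hij : i ≠ j) (hjl : j ≠ l) (hil : i ≠ l)
    {x : Fin 3 × Fin n → ℚ} :
    x ∈ axisSub i ↔ comp j x = 0 ∧ comp l x = 0 := by
  refine ⟨fun h => ⟨h _ hij.symm, h _ hil.symm⟩, fun h m hm => ?_⟩
  by_cases h' : m = j
  · exact h' ▸ h.1
  · exact (ne_and_ne_iff hij hjl hil m).1 ⟨hm, h'⟩ ▸ h.2

theorem mem_graphSub_iff {i j l : Fin 3} (hij : i ≠ j) (hjl : j ≠ l) (hil : i ≠ l)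
    {r : Module.End ℚ (Fin n → ℚ)} {x : Fin 3 × Fin n → ℚ} :
    x ∈ graphSub i j r ↔ comp j x = - r (comp i x) ∧ comp l x = 0 := by
  refine ⟨fun h => ⟨h.1, h.2 _ hil.symm hjl.symm⟩, fun h => ⟨h.1, fun m hm hm' => ?_⟩⟩
  exact (ne_and_ne_iff hij hjl hil m).1 ⟨hm, hm'⟩ ▸ h.2

theorem comps_incl {i j l : Fin 3} (hij : i ≠ j) (hjl : j ≠ l) (hil : i ≠ l)
    (y : Fin n → ℚ) :
    comp i (incl i y) = y ∧ comp j (incl i y) = 0 ∧ comp l (incl i y) = 0 ∧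
    comp j (incl j y) = y ∧ comp i (incl j y) = 0 ∧ comp l (incl j y) = 0 ∧
    comp l (incl l y) = y ∧ comp i (incl l y) = 0 ∧ comp j (incl l y) = 0 :=
  ⟨comp_incl_self _ _, comp_incl_of_ne hij.symm _, comp_incl_of_ne hil.symm _,
    comp_incl_self _ _, comp_incl_of_ne hij _, comp_incl_of_ne hjl.symm _,
    comp_incl_self _ _, comp_incl_of_ne hil _, comp_incl_of_ne hjl _⟩

theorem mem_axisSub_sup_iff {i j l : Fin 3} (hij : i ≠ j) (hjl : j ≠ l) (hil : i ≠ l)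
    {x : Fin 3 × Fin n → ℚ} :
    x ∈ axisSub i ⊔ axisSub j ↔ comp l x = 0 := by
  constructor
  · intro h
    obtain ⟨a, ha, b, hb, rfl⟩ := Submodule.mem_sup.1 h
    rw [map_add, ha _ hil.symm, hb _ hjl.symm, add_zero]
  · intro h
    have hx : x = incl i (comp i x) + incl j (comp j x) := by
      apply eq_of_comp hij hjl hil <;> simp [comps_incl hij hjl hil, h]
    rw [hx]
    refine add_mem (Submodule.mem_sup_left ?_) (Submodule.mem_sup_right ?_)
    · exact fun m hm => comp_incl_of_ne hm _
    · exact fun m hm => comp_incl_of_ne hm _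

theorem mem_graphSub_sup_axisSub_iff {i j l : Fin 3} (hij : i ≠ j) (hjl : j ≠ l) (hil : i ≠ l)
    {r : Module.End ℚ (Fin n → ℚ)} {x : Fin 3 × Fin n → ℚ} :
    x ∈ graphSub i j r ⊔ axisSub l ↔ comp j x = - r (comp i x) := by
  constructor
  · intro h
    obtain ⟨a, ha, b, hb, rfl⟩ := Submodule.mem_sup.1 h
    rw [map_add, map_add, hb _ hil, hb _ hjl, add_zero, add_zero, ha.1]
  · intro h
    have hx : x = (incl i (comp i x) + incl j (comp j x)) + incl l (comp l x) := by
      apply eq_of_comp hij hjl hil <;> simp [comps_incl hij hjl hil]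
    rw [hx]
    refine add_mem (Submodule.mem_sup_left ?_) (Submodule.mem_sup_right ?_)
    · rw [mem_graphSub_iff hij hjl hil]
      simp [comps_incl hij hjl hil, h]
    · exact fun m hm => comp_incl_of_ne hm _

/-- Composition of graphs. -/
theorem graphSub_mul {i j l : Fin 3} (hij : i ≠ j) (hjl : j ≠ l) (hil : i ≠ l)
    (r s : Module.End ℚ (Fin n → ℚ)) :
    (graphSub i j r ⊔ graphSub j l s) ⊓ (axisSub i ⊔ axisSub l) = graphSub i l (s * r) := by
  ext x
  rw [Submodule.mem_inf, mem_axisSub_sup_iff hil hjl.symm hij,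
    mem_graphSub_iff hil hjl.symm hij]
  constructor
  · rintro ⟨h, h0⟩
    obtain ⟨a, ha, b, hb, rfl⟩ := Submodule.mem_sup.1 h
    rw [mem_graphSub_iff hij hjl hil] at ha
    rw [mem_graphSub_iff hjl hil.symm hij.symm] at hb
    rw [map_add] at h0
    refine ⟨?_, by rw [map_add]; exact h0⟩
    have : comp j b = r (comp i a) := by
      rw [ha.1] at h0
      exact (neg_add_eq_zero.1 h0).symm
    simp [ha, hb, this]
  · rintro ⟨h1, h2⟩
    refine ⟨?_, h2⟩
    have hx : x = (incl i (comp i x) + incl j (- r (comp i x))) +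
        (incl j (r (comp i x)) + incl l (comp l x)) := by
      apply eq_of_comp hij hjl hil <;> simp [comps_incl hij hjl hil, h2]
    rw [hx]
    refine add_mem (Submodule.mem_sup_left ?_) (Submodule.mem_sup_right ?_)
    · rw [mem_graphSub_iff hij hjl hil]
      simp [comps_incl hij hjl hil]
    · rw [mem_graphSub_iff hjl hil.symm hij.symm]
      simp [comps_incl hij hjl hil, h1]

/-- Differences of graphs. -/
theorem graphSub_sub {i j l : Fin 3} (hij : i ≠ j) (hjl : j ≠ l) (hil : i ≠ l)
    (r s : Module.End ℚ (Fin n → ℚ)) :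
    (graphSub i j r ⊔ (graphSub i j s ⊔ axisSub l) ⊓ (graphSub i l 1 ⊔ axisSub j)) ⊓
      (axisSub l ⊔ axisSub j) = graphSub l j (r - s) := by
  ext x
  rw [Submodule.mem_inf, mem_axisSub_sup_iff hjl.symm hij.symm hil.symm,
    mem_graphSub_iff hjl.symm hij.symm hil.symm]
  constructor
  · rintro ⟨h, h0⟩
    obtain ⟨a, ha, b, ⟨hb, hb'⟩, rfl⟩ := Submodule.mem_sup.1 h
    rw [mem_graphSub_iff hij hjl hil] at ha
    rw [SetLike.mem_coe, mem_graphSub_sup_axisSub_iff hij hjl hil] at hb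
    rw [SetLike.mem_coe, mem_graphSub_sup_axisSub_iff hil hjl.symm hij] at hb'
    refine ⟨?_, h0⟩
    rw [map_add] at h0
    have : comp i b = - comp i a := (neg_eq_of_add_eq_zero_right h0).symm
    simp [ha, hb, hb', this, neg_add_eq_sub]
  · rintro ⟨h1, h2⟩
    refine ⟨?_, h2⟩
    have hx : x = (incl i (comp l x) + incl j (- r (comp l x))) +
        (incl i (- comp l x) + incl j (s (comp l x)) + incl l (comp l x)) := by
      apply eq_of_comp hij hjl hil <;> simp [comps_incl hij hjl hil, h1, h2]
      abel
    rw [hx]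
    refine add_mem (Submodule.mem_sup_left ?_) (Submodule.mem_sup_right ⟨?_, ?_⟩)
    · rw [mem_graphSub_iff hij hjl hil]
      simp [comps_incl hij hjl hil]
    · rw [SetLike.mem_coe, mem_graphSub_sup_axisSub_iff hij hjl hil]
      simp [comps_incl hij hjl hil]
    · rw [SetLike.mem_coe, mem_graphSub_sup_axisSub_iff hil hjl.symm hij]
      simp [comps_incl hij hjl hil]

/-- Images of graphs. -/
theorem graphSub_sup_axisSub_inf {i j l : Fin 3} (hij : i ≠ j) (hjl : j ≠ l) (hil : i ≠ l)
    (r : Module.End ℚ (Fin n → ℚ)) :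
    (graphSub i j r ⊔ axisSub i) ⊓ axisSub j = imageSub j r := by
  ext x
  rw [Submodule.mem_inf, mem_axisSub_iff hij.symm hil hjl]
  constructor
  · rintro ⟨h, h1, h2⟩
    obtain ⟨a, ha, b, hb, rfl⟩ := Submodule.mem_sup.1 h
    rw [mem_graphSub_iff hij hjl hil] at ha
    refine ⟨r (- comp i a), ⟨_, rfl⟩, ?_⟩
    apply eq_of_comp hij hjl hil
    · rw [h1]; simp [comps_incl hij hjl hil]
    · simp [comps_incl hij hjl hil, ha, hb _ hij.symm]
    · rw [h2]; simp [comps_incl hij hjl hil]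
  · rintro ⟨_, ⟨y, rfl⟩, rfl⟩
    simp only [comps_incl hij hjl hil, and_self, and_true]
    have hx : incl j (r y) = (incl i (-y) + incl j (r y)) + incl i y := by simp
    rw [hx]
    refine add_mem (Submodule.mem_sup_left ?_) (Submodule.mem_sup_right ?_)
    · rw [mem_graphSub_iff hij hjl hil]
      simp [comps_incl hij hjl hil]
    · exact fun m hm => comp_incl_of_ne hm _

/-- Read from the other side, the graph of an invertible map is the graph of its inverse. This is
the source of closure under inverses in the coordinate ring. -/
theorem graphSub_swap {i j l : Fin 3} (hij : i ≠ j) (hjl : j ≠ l) (hil : i ≠ l)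
    {r s : Module.End ℚ (Fin n → ℚ)} (hrs : r * s = 1) (hsr : s * r = 1) :
    graphSub i j r = graphSub j i s := by
  have h1 : ∀ y, r (s y) = y := fun y => by rw [← Module.End.mul_apply, hrs]; rfl
  have h2 : ∀ y, s (r y) = y := fun y => by rw [← Module.End.mul_apply, hsr]; rfl
  ext x
  rw [mem_graphSub_iff hij hjl hil, mem_graphSub_iff hij.symm hil hjl]
  refine and_congr_left fun _ => ⟨fun h => ?_, fun h => ?_⟩
  · rw [h, map_neg, h2, neg_neg]
  · rw [h, map_neg, h1, neg_neg]

theorem graphSub_zero {i j l : Fin 3} (hij : i ≠ j) (hjl : j ≠ l) (hil : i ≠ l)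
    : graphSub i j (0 : Module.End ℚ (Fin n → ℚ)) = axisSub i := by
  ext x
  rw [mem_graphSub_iff hij hjl hil, mem_axisSub_iff hij hjl hil]
  simp

end GraphCalculus

/-! ### The positive definite forms with Gram blocks `1`, `D`, `1 + J` -/

section Forms

variable {n : ℕ}

/-- The diagonal endomorphism of `ℚ^n` with given diagonal. -/
def diagEnd : (Fin n → ℚ) →+* Module.End ℚ (Fin n → ℚ) where
  toFun d := LinearMap.mulLeft ℚ d
  map_one' := LinearMap.mulLeft_one _ _
  map_mul' := LinearMap.mulLeft_mul _ _
  map_zero' := LinearMap.mulLeft_zero_eq_zero _ _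
  map_add' a b := by ext; simp [add_mul]

@[simp] theorem diagEnd_apply (d y : Fin n → ℚ) : diagEnd d y = d * y := rfl

/-- The endomorphism of `ℚ^n` whose matrix has all entries `1`. -/
def onesEnd : Module.End ℚ (Fin n → ℚ) where
  toFun y _ := ∑ t, y t
  map_add' y z := by ext; simp [Finset.sum_add_distrib]
  map_smul' c y := by ext; simp [Finset.mul_sum]

theorem onesEnd_apply (y : Fin n → ℚ) (s : Fin n) : onesEnd y s = ∑ t, y t := rfl

/-- The diagonal blocks of the Gram matrix of `blockForm`. -/
def block (d : Fin n → ℚ) : Fin 3 → Module.End ℚ (Fin n → ℚ) :=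
  ![1, diagEnd d, 1 + onesEnd]

theorem dotProduct_onesEnd (x y : Fin n → ℚ) :
    x ⬝ᵥ onesEnd y = (∑ t, x t) * ∑ t, y t := by
  simp [dotProduct, onesEnd_apply, Finset.sum_mul]

theorem dotProduct_block_comm (d : Fin n → ℚ) (i : Fin 3) (x y : Fin n → ℚ) :
    x ⬝ᵥ block d i y = y ⬝ᵥ block d i x := by
  fin_cases i
  · exact dotProduct_comm x y
  · simp only [dotProduct, block, Fin.mk_one, Matrix.cons_val_one, Matrix.cons_val_zero,
      diagEnd_apply, Pi.mul_apply]
    exact Finset.sum_congr rfl fun t _ => by ring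
  · change x ⬝ᵥ (y + onesEnd y) = y ⬝ᵥ (x + onesEnd x)
    rw [dotProduct_add, dotProduct_add, dotProduct_onesEnd, dotProduct_onesEnd,
      dotProduct_comm x y, mul_comm]

theorem dotProduct_block_nonneg {d : Fin n → ℚ} (hd : ∀ t, 0 < d t) (i : Fin 3)
    (x : Fin n → ℚ) : 0 ≤ x ⬝ᵥ block d i x := by
  fin_cases i
  · exact Finset.sum_nonneg fun t _ => mul_self_nonneg (x t)
  · exact Finset.sum_nonneg fun t _ => by
      change 0 ≤ x t * (d t * x t)
      nlinarith [mul_nonneg (hd t).le (mul_self_nonneg (x t))]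
  · change 0 ≤ x ⬝ᵥ (x + onesEnd x)
    rw [dotProduct_add, dotProduct_onesEnd]
    exact add_nonneg (Finset.sum_nonneg fun t _ => mul_self_nonneg (x t)) (mul_self_nonneg _)

theorem eq_zero_of_dotProduct_block {d : Fin n → ℚ} (hd : ∀ t, 0 < d t) (i : Fin 3)
    {x : Fin n → ℚ} (h : x ⬝ᵥ block d i x = 0) : x = 0 := by
  fin_cases i
  · exact dotProduct_self_eq_zero.1 h
  · have h' : ∑ t, x t * (d t * x t) = 0 := h
    rw [Finset.sum_eq_zero_iff_of_nonneg fun t _ => by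
      nlinarith [mul_nonneg (hd t).le (mul_self_nonneg (x t))]] at h'
    ext t
    simpa [(hd t).ne'] using h' t (Finset.mem_univ t)
  · change x ⬝ᵥ (x + onesEnd x) = 0 at h
    rw [dotProduct_add, dotProduct_onesEnd] at h
    have h1 : 0 ≤ x ⬝ᵥ x := Finset.sum_nonneg fun t _ => mul_self_nonneg (x t)
    have h2 := mul_self_nonneg (∑ t, x t)
    exact dotProduct_self_eq_zero.1 (by linarith)

/-- The orthogonal sum of the forms on `ℚ^n` with Gram matrices `1`, `diag(d)` and the sum of `1`
and the all-ones matrix. -/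
def blockForm (d : Fin n → ℚ) (hd : ∀ t, 0 < d t) : PosDefForm (Fin 3 × Fin n) where
  form := LinearMap.mk₂ ℚ (fun x y => ∑ i, comp i x ⬝ᵥ block d i (comp i y))
    (fun x x' y => by simp [add_dotProduct, Finset.sum_add_distrib])
    (fun c x y => by simp [Finset.mul_sum])
    (fun x y y' => by simp [dotProduct_add, Finset.sum_add_distrib])
    (fun c x y => by simp [Finset.mul_sum])
  symm x y := by
    simp only [LinearMap.mk₂_apply]
    exact Finset.sum_congr rfl fun i _ => dotProduct_block_comm d i _ _
  pos x hx := by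
    rw [LinearMap.mk₂_apply]
    refine lt_of_le_of_ne (Finset.sum_nonneg fun i _ => dotProduct_block_nonneg hd i _) ?_
    intro h
    apply hx
    have h0 := (Finset.sum_eq_zero_iff_of_nonneg
      fun i _ => dotProduct_block_nonneg hd i (comp i x)).1 h.symm
    ext ⟨i, t⟩
    exact congrFun (eq_zero_of_dotProduct_block hd i (h0 i (Finset.mem_univ i))) t

theorem blockForm_apply (d : Fin n → ℚ) (hd : ∀ t, 0 < d t) (x y : Fin 3 × Fin n → ℚ) :
    (blockForm d hd).form x y = ∑ i, comp i x ⬝ᵥ block d i (comp i y) := rfl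

theorem blockForm_apply_of_ne (d : Fin n → ℚ) (hd : ∀ t, 0 < d t) {i j l : Fin 3} (hij : i ≠ j)
    (hjl : j ≠ l) (hil : i ≠ l) (x y : Fin 3 × Fin n → ℚ) :
    (blockForm d hd).form x y = comp i x ⬝ᵥ block d i (comp i y) +
      comp j x ⬝ᵥ block d j (comp j y) + comp l x ⬝ᵥ block d l (comp l y) := by
  have h : (Finset.univ : Finset (Fin 3)) = {i, j, l} := by revert i j l; decide
  rw [blockForm_apply, h, Finset.sum_insert (by simp [hij, hil]), Finset.sum_pair hjl, add_assoc]

theorem blockForm_incl_left (d : Fin n → ℚ) (hd : ∀ t, 0 < d t) (i : Fin 3) (w : Fin n → ℚ)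
    (y : Fin 3 × Fin n → ℚ) :
    (blockForm d hd).form (incl i w) y = w ⬝ᵥ block d i (comp i y) := by
  rw [blockForm_apply, Finset.sum_eq_single i, comp_incl_self]
  · intro j _ hj
    rw [comp_incl_of_ne hj, zero_dotProduct]
  · simp

/-- The axis consists of the vectors with components `w` and `-w`. Pairing one with `x` gives the
dot product of `w` with the difference of the two sides, and `w` is arbitrary. -/
theorem mem_orthogonal_graphSub_one (d : Fin n → ℚ) (hd : ∀ t, 0 < d t) {i j l : Fin 3}
    (hij : i ≠ j) (hjl : j ≠ l) (hil : i ≠ l) {x : Fin 3 × Fin n → ℚ} :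
    x ∈ (blockForm d hd).form.orthogonal (graphSub i j 1) ↔
      block d i (comp i x) = block d j (comp j x) := by
  rw [LinearMap.BilinForm.mem_orthogonal_iff]
  constructor
  · intro h
    rw [← sub_eq_zero]
    refine dotProduct_eq_zero _ fun w => ?_
    have := h (incl i w - incl j w) (by
      rw [mem_graphSub_iff hij hjl hil]; simp [comps_incl hij hjl hil])
    rw [map_sub, LinearMap.sub_apply, blockForm_incl_left,
      blockForm_incl_left] at this
    rw [sub_dotProduct, dotProduct_comm, dotProduct_comm _ w, this]
  · intro h y hy
    rw [mem_graphSub_iff hij hjl hil] at hy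
    rw [blockForm_apply_of_ne d hd hij hjl hil, hy.1, hy.2, h]
    simp

/-- The graph of `diag(d)` in terms of the orthocomplement of the frame. -/
theorem orthogonal_graphSub_inf_of_block_zero (d : Fin n → ℚ) (hd : ∀ t, 0 < d t) {j l : Fin 3}
    (hj : 0 ≠ j) (hjl : j ≠ l) (hl : 0 ≠ l) :
    (blockForm d hd).form.orthogonal (graphSub 0 j 1) ⊓ (axisSub 0 ⊔ axisSub j) =
      graphSub j 0 (- block d j) := by
  ext x
  rw [Submodule.mem_inf, mem_orthogonal_graphSub_one d hd hj hjl hl,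
    mem_axisSub_sup_iff hj hjl hl, mem_graphSub_iff hj.symm hl hjl]
  -- The block with index `0` is the identity, so the condition already solves for `comp 0 x`. The
  -- minus sign in the statement cancels the one built into `graphSub`.
  simp [block]

end Forms

/-! ### The coordinate ring of a family of subspaces -/

section Families

variable {κ : Type*} {n : κ → ℕ}

/-- A set of families of subspaces that contains the canonical frames and is closed under the
pointwise operations. -/
structure IsFrameFamily {κ : Type*} {n : κ → ℕ} (d : ∀ k, Fin (n k) → ℚ) (hd : ∀ k t, 0 < d k t)
    (C : Set (∀ k, Submodule ℚ (Fin 3 × Fin (n k) → ℚ))) : Prop where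
  sup_mem : ∀ {X Y}, X ∈ C → Y ∈ C → (fun k => X k ⊔ Y k) ∈ C
  inf_mem : ∀ {X Y}, X ∈ C → Y ∈ C → (fun k => X k ⊓ Y k) ∈ C
  orthogonal_mem : ∀ {X}, X ∈ C → (fun k => (blockForm (d k) (hd k)).form.orthogonal (X k)) ∈ C
  axisSub_mem : ∀ i, (fun _ => axisSub i) ∈ C
  graphSub_one_mem : ∀ i j, i ≠ j → (fun _ => graphSub i j 1) ∈ C

namespace IsFrameFamily

variable {d : ∀ k, Fin (n k) → ℚ} {hd : ∀ k t, 0 < d k t}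
  {C : Set (∀ k, Submodule ℚ (Fin 3 × Fin (n k) → ℚ))}

theorem graphSub_mul_mem (hC : IsFrameFamily d hd C) {i j l : Fin 3} (hij : i ≠ j) (hjl : j ≠ l)
    (hil : i ≠ l) {r s : ∀ k, Module.End ℚ (Fin (n k) → ℚ)}
    (hr : (fun k => graphSub i j (r k)) ∈ C) (hs : (fun k => graphSub j l (s k)) ∈ C) :
    (fun k => graphSub i l (s k * r k)) ∈ C := by
  have := hC.inf_mem (hC.sup_mem hr hs) (hC.sup_mem (hC.axisSub_mem i) (hC.axisSub_mem l))
  simpa only [graphSub_mul hij hjl hil] using this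

/-- Composing with an axis, the graph of `1`, moves a coordinate to another pair of summands without
changing it. -/
theorem graphSub_right_mem (hC : IsFrameFamily d hd C) {i j l : Fin 3} (hij : i ≠ j) (hjl : j ≠ l)
    (hil : i ≠ l) {r : ∀ k, Module.End ℚ (Fin (n k) → ℚ)}
    (hr : (fun k => graphSub i j (r k)) ∈ C) : (fun k => graphSub i l (r k)) ∈ C := by
  simpa using hC.graphSub_mul_mem hij hjl hil hr (hC.graphSub_one_mem j l hjl)

theorem graphSub_left_mem (hC : IsFrameFamily d hd C) {i j l : Fin 3} (hij : i ≠ j) (hjl : j ≠ l)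
    (hil : i ≠ l) {r : ∀ k, Module.End ℚ (Fin (n k) → ℚ)}
    (hr : (fun k => graphSub i j (r k)) ∈ C) : (fun k => graphSub l j (r k)) ∈ C := by
  simpa using hC.graphSub_mul_mem hil.symm hij hjl.symm (hC.graphSub_one_mem l i hil.symm) hr

/-- Changing source and target one at a time, always through the third index, reaches all six
ordered pairs. So membership in the coordinate ring can be tested at any single pair. -/
theorem graphSub_mem_of_mem (hC : IsFrameFamily d hd C) {i j : Fin 3} (hij : i ≠ j)
    {r : ∀ k, Module.End ℚ (Fin (n k) → ℚ)} (hr : (fun k => graphSub i j (r k)) ∈ C)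
    (i' j' : Fin 3) (hij' : i' ≠ j') : (fun k => graphSub i' j' (r k)) ∈ C := by
  obtain ⟨l, hil, hjl⟩ : ∃ l : Fin 3, i ≠ l ∧ j ≠ l := by clear hr; revert i j; decide
  have h1 := hC.graphSub_right_mem hij hjl hil hr
  have h2 := hC.graphSub_left_mem hij hjl hil hr
  have h3 := hC.graphSub_left_mem hil hjl.symm hij h1
  have h4 := hC.graphSub_right_mem hjl.symm hij.symm hil.symm h2
  have h5 := hC.graphSub_right_mem hjl hil.symm hij.symm h3
  have h : (i' = i ∧ j' = j) ∨ (i' = i ∧ j' = l) ∨ (i' = l ∧ j' = j) ∨ (i' = j ∧ j' = l) ∨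
      (i' = l ∧ j' = i) ∨ (i' = j ∧ j' = i) := by
    clear h1 h2 h3 h4 h5 hr; revert i j l i' j'; decide
  rcases h with ⟨rfl, rfl⟩ | ⟨rfl, rfl⟩ | ⟨rfl, rfl⟩ | ⟨rfl, rfl⟩ | ⟨rfl, rfl⟩ | ⟨rfl, rfl⟩ <;>
    assumption

theorem graphSub_sub_mem (hC : IsFrameFamily d hd C) {r s : ∀ k, Module.End ℚ (Fin (n k) → ℚ)}
    (hr : ∀ i j, i ≠ j → (fun k => graphSub i j (r k)) ∈ C)
    (hs : ∀ i j, i ≠ j → (fun k => graphSub i j (s k)) ∈ C) (i j : Fin 3) (hij : i ≠ j) :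
    (fun k => graphSub i j (r k - s k)) ∈ C := by
  refine hC.graphSub_mem_of_mem (i := 2) (j := 1) (by decide) ?_ i j hij
  have h01 : (0 : Fin 3) ≠ 1 := by decide
  have h12 : (1 : Fin 3) ≠ 2 := by decide
  have h02 : (0 : Fin 3) ≠ 2 := by decide
  have := hC.inf_mem (hC.sup_mem (hr 0 1 h01) (hC.inf_mem
    (hC.sup_mem (hs 0 1 h01) (hC.axisSub_mem 2))
    (hC.sup_mem (hC.graphSub_one_mem 0 2 h02) (hC.axisSub_mem 1))))
    (hC.sup_mem (hC.axisSub_mem 2) (hC.axisSub_mem 1))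
  simpa only [graphSub_sub h01 h12 h02] using this

theorem graphSub_zero_mem (hC : IsFrameFamily d hd C) (i j : Fin 3) (hij : i ≠ j) :
    (fun k => graphSub i j (0 : Module.End ℚ (Fin (n k) → ℚ))) ∈ C := by
  obtain ⟨l, hil, hjl⟩ : ∃ l : Fin 3, i ≠ l ∧ j ≠ l := by revert i j; decide
  simpa only [graphSub_zero hij hjl hil] using hC.axisSub_mem i

/-- The coordinate ring of a family of subspaces containing the canonical frames. -/
def coordRing (hC : IsFrameFamily d hd C) : Subring (∀ k, Module.End ℚ (Fin (n k) → ℚ)) where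
  carrier := {r | ∀ i j, i ≠ j → (fun k => graphSub i j (r k)) ∈ C}
  one_mem' := hC.graphSub_one_mem
  zero_mem' := hC.graphSub_zero_mem
  mul_mem' {r s} hr hs := hC.graphSub_mem_of_mem (i := 0) (j := 2) (by decide)
    (hC.graphSub_mul_mem (by decide) (by decide) (by decide) (hs 0 1 (by decide))
      (hr 1 2 (by decide)))
  -- The available lattice term computes differences, so `-r` is `0 - r` and `r + s` is `r - (0 -
  -- s)`.
  neg_mem' {r} hr := by simpa using hC.graphSub_sub_mem hC.graphSub_zero_mem hr
  add_mem' {r s} hr hs := by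
    simpa using hC.graphSub_sub_mem hr (hC.graphSub_sub_mem hC.graphSub_zero_mem hs)

theorem mem_coordRing_of_mem (hC : IsFrameFamily d hd C) {i j : Fin 3} (hij : i ≠ j)
    {r : ∀ k, Module.End ℚ (Fin (n k) → ℚ)} (hr : (fun k => graphSub i j (r k)) ∈ C) :
    r ∈ hC.coordRing := hC.graphSub_mem_of_mem hij hr

theorem inv_mem_coordRing (hC : IsFrameFamily d hd C) {r s : ∀ k, Module.End ℚ (Fin (n k) → ℚ)}
    (hrs : r * s = 1) (hsr : s * r = 1) (hr : r ∈ hC.coordRing) : s ∈ hC.coordRing := by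
  refine hC.mem_coordRing_of_mem (i := 1) (j := 0) (by decide) ?_
  have h := hr 0 1 (by decide)
  have h' : ∀ k, graphSub 0 1 (r k) = graphSub 1 0 (s k) := fun k =>
    graphSub_swap (l := 2) (by decide) (by decide) (by decide) (congrFun hrs k) (congrFun hsr k)
  simpa only [h'] using h

/-- The orthocomplement of an axis, cut down to the sum of its two summands, is the graph of a Gram
block: here the form enters the coordinates. -/
theorem block_mem_coordRing (hC : IsFrameFamily d hd C) {j : Fin 3} (hj : 0 ≠ j) :
    (fun k => block (d k) j) ∈ hC.coordRing := by
  obtain ⟨l, hl, hjl⟩ : ∃ l : Fin 3, 0 ≠ l ∧ j ≠ l := by revert j; decide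
  rw [← neg_mem_iff]
  refine hC.mem_coordRing_of_mem hj.symm ?_
  have := hC.inf_mem (hC.orthogonal_mem (hC.graphSub_one_mem 0 j hj))
    (hC.sup_mem (hC.axisSub_mem 0) (hC.axisSub_mem j))
  simpa only [orthogonal_graphSub_inf_of_block_zero _ _ hj hjl hl, Pi.neg_apply] using this

theorem diagEnd_mem_coordRing (hC : IsFrameFamily d hd C) :
    (fun k => diagEnd (d k)) ∈ hC.coordRing := hC.block_mem_coordRing (j := 1) (by decide)

theorem onesEnd_mem_coordRing (hC : IsFrameFamily d hd C) :
    (fun _ => onesEnd) ∈ hC.coordRing := by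
  have := sub_mem (hC.block_mem_coordRing (j := 2) (by decide)) (one_mem _)
  convert this using 1
  ext1 k
  exact (add_sub_cancel_left _ _).symm

theorem imageSub_mem (hC : IsFrameFamily d hd C) {r : ∀ k, Module.End ℚ (Fin (n k) → ℚ)}
    (hr : r ∈ hC.coordRing) (j : Fin 3) : (fun k => imageSub j (r k)) ∈ C := by
  obtain ⟨i, l, hij, hjl, hil⟩ : ∃ i l : Fin 3, i ≠ j ∧ j ≠ l ∧ i ≠ l := by revert j; decide
  have := hC.inf_mem (hC.sup_mem (hr i j hij) (hC.axisSub_mem i)) (hC.axisSub_mem j)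
  simpa only [graphSub_sup_axisSub_inf hij hjl hil] using this

end IsFrameFamily

end Families

/-! ### Lines as lattice terms in graphs and images -/

section Lines

variable {n : ℕ}

theorem mem_imageSub_sup_iff {q : Module.End ℚ (Fin n → ℚ)} {i j l : Fin 3} (hij : i ≠ j)
    (hjl : j ≠ l) (hil : i ≠ l) {x : Fin 3 × Fin n → ℚ} :
    x ∈ imageSub i q ⊔ (axisSub j ⊔ axisSub l) ↔ comp i x ∈ LinearMap.range q := by
  constructor
  · intro h
    obtain ⟨_, ⟨y, hy, rfl⟩, b, hb, rfl⟩ := Submodule.mem_sup.1 h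
    rw [mem_axisSub_sup_iff hjl hil.symm hij.symm] at hb
    rw [map_add, hb, add_zero, comp_incl_self]
    exact hy
  · intro h
    have hx : x = incl i (comp i x) + (incl j (comp j x) + incl l (comp l x)) := by
      apply eq_of_comp hij hjl hil <;> simp [comps_incl hij hjl hil]
    rw [hx]
    refine add_mem (Submodule.mem_sup_left ⟨_, h, rfl⟩) (Submodule.mem_sup_right ?_)
    rw [mem_axisSub_sup_iff hjl hil.symm hij.symm]
    simp [comps_incl hij hjl hil]

/-- A line not in `E₁ + E₂`, in terms of graphs and an image. -/
theorem span_singleton_eq_of_comp {x : Fin 3 × Fin n → ℚ} {r s q : Module.End ℚ (Fin n → ℚ)}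
    (h1 : comp 1 x = - r (comp 0 x)) (h2 : comp 2 x = - s (comp 0 x))
    (hq : LinearMap.range q = Submodule.span ℚ {comp 0 x}) :
    (graphSub 0 1 r ⊔ axisSub 2) ⊓ (graphSub 0 2 s ⊔ axisSub 1) ⊓
      (imageSub 0 q ⊔ (axisSub 1 ⊔ axisSub 2)) = Submodule.span ℚ {x} := by
  have h01 : (0 : Fin 3) ≠ 1 := by decide
  have h12 : (1 : Fin 3) ≠ 2 := by decide
  have h02 : (0 : Fin 3) ≠ 2 := by decide
  ext y
  rw [Submodule.mem_inf, Submodule.mem_inf, mem_graphSub_sup_axisSub_iff h01 h12 h02,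
    mem_graphSub_sup_axisSub_iff h02 h12.symm h01, mem_imageSub_sup_iff h01 h12 h02, hq,
    Submodule.mem_span_singleton, Submodule.mem_span_singleton]
  constructor
  · rintro ⟨⟨hy1, hy2⟩, c, hc⟩
    refine ⟨c, eq_of_comp h01 h12 h02 ?_ ?_ ?_⟩ <;> simp [hy1, hy2, h1, h2, ← hc]
  · rintro ⟨c, rfl⟩
    exact ⟨⟨by simp [h1], by simp [h2]⟩, c, by simp⟩

/-- A line in `E₁ + E₂` but not in `E₂`, in terms of graphs and an image. -/
theorem span_singleton_eq_of_comp_zero {x : Fin 3 × Fin n → ℚ}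
    {s q : Module.End ℚ (Fin n → ℚ)}
    (h1 : comp 0 x = 0) (h2 : comp 2 x = - s (comp 1 x))
    (hq : LinearMap.range q = Submodule.span ℚ {comp 1 x}) :
    graphSub 1 2 s ⊓ (imageSub 1 q ⊔ (axisSub 0 ⊔ axisSub 2)) = Submodule.span ℚ {x} := by
  have h01 : (0 : Fin 3) ≠ 1 := by decide
  have h12 : (1 : Fin 3) ≠ 2 := by decide
  have h02 : (0 : Fin 3) ≠ 2 := by decide
  ext y
  rw [Submodule.mem_inf, mem_graphSub_iff h12 h02.symm h01.symm,
    mem_imageSub_sup_iff h01.symm h02 h12, hq,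
    Submodule.mem_span_singleton, Submodule.mem_span_singleton]
  constructor
  · rintro ⟨⟨hy1, hy2⟩, c, hc⟩
    refine ⟨c, eq_of_comp h01 h12 h02 ?_ ?_ ?_⟩ <;> simp [hy1, hy2, h1, h2, ← hc]
  · rintro ⟨c, rfl⟩
    exact ⟨⟨by simp [h2], by simp [h1]⟩, c, by simp⟩

theorem imageSub_eq_span_singleton {w : Fin n → ℚ} {q : Module.End ℚ (Fin n → ℚ)}
    (hq : LinearMap.range q = Submodule.span ℚ {w}) (i : Fin 3) :
    imageSub i q = Submodule.span ℚ {incl i w} := by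
  rw [imageSub, hq, Submodule.map_span, Set.image_singleton]

theorem exists_end_apply_eq {x : Fin n → ℚ} (hx : x ≠ 0) (w : Fin n → ℚ) :
    ∃ r : Module.End ℚ (Fin n → ℚ), r x = w := by
  obtain ⟨t, ht⟩ := Function.ne_iff.1 hx
  refine ⟨(LinearMap.toSpanSingleton ℚ _ ((x t)⁻¹ • w)).comp (LinearMap.proj t), ?_⟩
  simp only [LinearMap.comp_apply, LinearMap.proj_apply, LinearMap.toSpanSingleton_apply, smul_smul]
  rw [mul_inv_cancel₀ ht, one_smul]

theorem exists_range_eq_span {x : Fin n → ℚ} (hx : x ≠ 0) :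
    ∃ q : Module.End ℚ (Fin n → ℚ), LinearMap.range q = Submodule.span ℚ {x} := by
  -- Nonvanishing of `x` serves only to provide an index, so that some coordinate projection onto
  -- `ℚ` exists.
  obtain ⟨t, -⟩ := Function.ne_iff.1 hx
  refine ⟨(LinearMap.toSpanSingleton ℚ _ x).comp (LinearMap.proj t), ?_⟩
  rw [LinearMap.range_comp, LinearMap.range_eq_top.2 (LinearMap.proj_surjective t),
    Submodule.map_top, LinearMap.range_toSpanSingleton]

/-- The range of `J` is the line of constant vectors, and multiplication by `f` carries it to the
line of `f`. -/
theorem range_diagEnd_mul_onesEnd [NeZero n] (f : Fin n → ℚ) :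
    LinearMap.range (diagEnd f * onesEnd) = Submodule.span ℚ {f} := by
  ext y
  rw [Submodule.mem_span_singleton]
  constructor
  · rintro ⟨z, rfl⟩
    refine ⟨∑ t, z t, ?_⟩
    ext s
    simp [onesEnd_apply, mul_comm]
  · rintro ⟨c, rfl⟩
    refine ⟨Pi.single 0 c, ?_⟩
    ext s
    simp [onesEnd_apply, mul_comm]

end Lines

/-! ### Each factor is generated by its canonical frame -/

section Generation

variable {n : ℕ}

/-- A ring of endomorphisms of `ℚ^n` that is closed under inverses and contains the all-ones matrix
and a diagonal matrix with distinct entries consists of all endomorphisms. -/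
theorem subring_eq_top {R : Subring (Module.End ℚ (Fin n → ℚ))} {d : Fin n → ℚ}
    (hinj : Function.Injective d) (hinv : ∀ r s, r * s = 1 → s * r = 1 → r ∈ R → s ∈ R)
    (hd : diagEnd d ∈ R) (h1 : onesEnd ∈ R) (r : Module.End ℚ (Fin n → ℚ)) : r ∈ R := by
  -- Rational scalars come from integer scalars and the inverse of the denominator; only here is
  -- closure under inverses needed.
  have hconst : ∀ c : ℚ, diagEnd (fun _ : Fin n => c) ∈ R := by
    intro c
    have hint : ∀ z : ℤ, diagEnd (fun _ : Fin n => (z : ℚ)) ∈ R := by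
      intro z
      have h : diagEnd (fun _ : Fin n => (z : ℚ)) = (z : Module.End ℚ (Fin n → ℚ)) :=
        map_intCast diagEnd z
      exact h ▸ intCast_mem R z
    have hden : diagEnd (fun _ : Fin n => (c.den : ℚ)⁻¹) ∈ R := by
      refine hinv (diagEnd fun _ => ((c.den : ℤ) : ℚ)) _ ?_ ?_ (hint _) <;>
      · rw [← map_mul, ← map_one diagEnd]
        congr 1
        ext t
        simp
    have := mul_mem (hint c.num) hden
    rw [← map_mul] at this
    convert this using 2
    ext t
    exact (Rat.num_div_den c).symm.trans (div_eq_mul_inv _ _)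
  have hsingle : ∀ (s : Fin n) (c : ℚ), diagEnd (Pi.single s c) ∈ R := by
    intro s c
    -- Lagrange interpolation: the product of the `D - d t` over `t ≠ s` is diagonal with its only
    -- nonzero entry at `s`, because the entries of `D` are distinct.
    have hprod : (∏ t ∈ Finset.univ.erase s, (d - fun _ => d t)) ∈ R.comap diagEnd := by
      refine prod_mem fun t _ => ?_
      exact sub_mem (S := Subring (Fin n → ℚ)) hd (hconst _)
    set f := ∏ t ∈ Finset.univ.erase s, (d - fun _ => d t) with hf
    have hs : f s ≠ 0 := by
      rw [hf, Finset.prod_apply, Finset.prod_ne_zero_iff]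
      intro t ht
      exact sub_ne_zero.2 fun h => (Finset.ne_of_mem_erase ht) (hinj h).symm
    have ht : ∀ t, t ≠ s → f t = 0 := by
      intro t ht
      rw [hf, Finset.prod_apply]
      exact Finset.prod_eq_zero (Finset.mem_erase.2 ⟨ht, Finset.mem_univ t⟩) (by simp)
    have := mul_mem (hconst (c / f s)) hprod
    rw [← map_mul] at this
    convert this using 2
    ext t
    by_cases h : t = s
    · subst h
      simp [div_mul_cancel₀ _ hs]
    · simp [h, ht t h]
  -- Matrix units are `E_ss J E_tt`, since all entries of `J` are `1`.
  have hr : r = ∑ s, ∑ t, diagEnd (Pi.single s (r (Pi.single t 1) s)) * onesEnd *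
      diagEnd (Pi.single t 1) := by
    refine LinearMap.pi_ext' fun t => LinearMap.ext_ring ?_
    ext s
    simp [onesEnd_apply, Pi.single_apply, Finset.sum_apply]
  rw [hr]
  exact sum_mem fun s _ => sum_mem fun t _ => mul_mem (mul_mem (hsingle _ _) h1) (hsingle _ _)

/-- Every subspace of `ℚ^(3n)` is generated by the canonical frame. -/
theorem IsFrameFamily.mem_of_unit {d : Unit → Fin n → ℚ} {hd : ∀ k t, 0 < d k t}
    {C : Set (∀ _ : Unit, Submodule ℚ (Fin 3 × Fin n → ℚ))} (hC : IsFrameFamily d hd C)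
    (hinj : Function.Injective (d ())) (X : Submodule ℚ (Fin 3 × Fin n → ℚ)) :
    (fun _ => X) ∈ C := by
  have hall : ∀ r : Module.End ℚ (Fin n → ℚ), (fun _ => r) ∈ hC.coordRing := by
    intro r
    refine subring_eq_top (R := hC.coordRing.comap (Pi.constRingHom Unit _)) hinj ?_ ?_ ?_ r
    · intro r s hrs hsr hr
      exact hC.inv_mem_coordRing (funext fun _ => hrs) (funext fun _ => hsr) hr
    · exact hC.diagEnd_mem_coordRing
    · exact hC.onesEnd_mem_coordRing
  have hX : X.FG := IsNoetherian.noetherian X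
  -- Joins reduce the claim to lines; the first nonzero component of a spanning vector decides which
  -- line formula applies.
  refine Submodule.fg_induction (motive := fun X _ => (fun _ => X) ∈ C) ?_ ?_ X hX
  · intro x
    by_cases h0 : comp 0 x = 0
    · by_cases h1 : comp 1 x = 0
      · by_cases h2 : comp 2 x = 0
        · have hx : x = incl 2 0 := by
            apply eq_of_comp (i := 0) (j := 1) (l := 2) <;> simp [h0, h1, h2]
          have := hC.imageSub_mem (hall 0) 2
          rw [hx, ← imageSub_eq_span_singleton (q := 0) (by simp)]
          exact this
        · obtain ⟨q, hq⟩ := exists_range_eq_span h2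
          have hx : x = incl 2 (comp 2 x) := by
            apply eq_of_comp (i := 0) (j := 1) (l := 2) <;> simp [h0, h1, comp_incl_of_ne]
          have := hC.imageSub_mem (hall q) 2
          rw [hx, ← imageSub_eq_span_singleton hq]
          exact this
      · obtain ⟨q, hq⟩ := exists_range_eq_span h1
        obtain ⟨s, hs⟩ := exists_end_apply_eq h1 (- comp 2 x)
        rw [← span_singleton_eq_of_comp_zero h0 (s := s) (by rw [hs, neg_neg]) hq]
        exact hC.inf_mem (hall s 1 2 (by decide)) (hC.sup_mem (hC.imageSub_mem (hall q) 1)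
          (hC.sup_mem (hC.axisSub_mem 0) (hC.axisSub_mem 2)))
    · obtain ⟨q, hq⟩ := exists_range_eq_span h0
      obtain ⟨r, hr⟩ := exists_end_apply_eq h0 (- comp 1 x)
      obtain ⟨s, hs⟩ := exists_end_apply_eq h0 (- comp 2 x)
      rw [← span_singleton_eq_of_comp (r := r) (s := s) (by rw [hr, neg_neg])
        (by rw [hs, neg_neg]) hq]
      exact hC.inf_mem (hC.inf_mem
        (hC.sup_mem (hall r 0 1 (by decide)) (hC.axisSub_mem 2))
        (hC.sup_mem (hall s 0 2 (by decide)) (hC.axisSub_mem 1)))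
        (hC.sup_mem (hC.imageSub_mem (hall q) 0)
          (hC.sup_mem (hC.axisSub_mem 1) (hC.axisSub_mem 2)))
  · intro Y Z _ _ hY hZ
    exact hC.sup_mem hY hZ

end Generation

/-! ### The canonical frame is an orthogonal 3-frame -/

section CanonicalFrame

variable {n : ℕ}

theorem incl_eq_sum (i : Fin 3) (y : Fin n → ℚ) :
    incl i y = ∑ t, y t • (Pi.single (i, t) 1 : Fin 3 × Fin n → ℚ) := by
  ext ⟨m, s⟩
  simp only [incl, LinearMap.coe_mk, AddHom.coe_mk, Finset.sum_apply, Pi.smul_apply,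
    Pi.single_apply, Prod.mk.injEq, smul_eq_mul, mul_ite, mul_one, mul_zero]
  by_cases h : m = i <;> simp [h]

theorem incl_single (i : Fin 3) (t : Fin n) :
    incl i (Pi.single t 1) = (Pi.single (i, t) 1 : Fin 3 × Fin n → ℚ) := by
  ext ⟨m, s⟩
  simp only [incl, LinearMap.coe_mk, AddHom.coe_mk, Pi.single_apply, Prod.mk.injEq]
  by_cases h : m = i <;> simp [h]

theorem canonicalFrame_pt (Φ : PosDefForm (Fin 3 × Fin n)) (i : Fin 3) :
    (canonicalFrame Φ).pt i = (axisSub i : Submodule ℚ (Fin 3 × Fin n → ℚ)) := by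
  change Submodule.span ℚ _ = _
  apply le_antisymm
  · rw [Submodule.span_le]
    rintro _ ⟨t, rfl⟩
    simp only [← incl_single]
    exact fun m hm => comp_incl_of_ne hm _
  · intro x hx
    obtain ⟨j, l, hij, hjl, hil⟩ : ∃ j l : Fin 3, i ≠ j ∧ j ≠ l ∧ i ≠ l := by
      clear hx; revert i; decide
    rw [mem_axisSub_iff hij hjl hil] at hx
    have hx : x = incl i (comp i x) := by
      apply eq_of_comp hij hjl hil <;> simp [comps_incl hij hjl hil, hx]
    rw [hx, incl_eq_sum]
    exact sum_mem fun t _ => Submodule.smul_mem _ _ (Submodule.subset_span ⟨t, rfl⟩)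

theorem canonicalFrame_ax (Φ : PosDefForm (Fin 3 × Fin n)) {i j : Fin 3} (hij : i ≠ j) :
    (canonicalFrame Φ).ax i j = (graphSub i j 1 : Submodule ℚ (Fin 3 × Fin n → ℚ)) := by
  obtain ⟨l, hjl, hil⟩ : ∃ l : Fin 3, j ≠ l ∧ i ≠ l := by revert i j; decide
  change Submodule.span ℚ _ = _
  apply le_antisymm
  · rw [Submodule.span_le]
    rintro _ ⟨t, rfl⟩
    simp only [← incl_single]
    rw [SetLike.mem_coe, mem_graphSub_iff hij hjl hil]
    simp [comps_incl hij hjl hil]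
  · intro x hx
    rw [mem_graphSub_iff hij hjl hil] at hx
    have hx : x = incl i (comp i x) - incl j (comp i x) := by
      apply eq_of_comp hij hjl hil <;> simp [comps_incl hij hjl hil, hx]
    rw [hx, incl_eq_sum, incl_eq_sum, ← Finset.sum_sub_distrib]
    refine sum_mem fun t _ => ?_
    rw [← smul_sub]
    exact Submodule.smul_mem _ _ (Submodule.subset_span ⟨t, rfl⟩)

/-- The defining conditions for 3-frames, with the joins and meets over indices expanded. -/
theorem isFrame_iff {L : Type*} [ModularOrtholattice L] (a : FrameData 3 L) :
    a.IsFrame ↔ ∀ j k l : Fin 3, j ≠ k → k ≠ l → j ≠ l →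
      a.pt j ⊓ (a.pt k ⊔ a.pt l) = a.pt j ⊓ (a.pt k ⊓ a.pt l) ∧
      a.pt j ⊓ a.ax j k = a.pt j ⊓ (a.pt k ⊓ a.pt l) ∧
      a.pt j ⊔ a.ax j k = a.pt j ⊔ a.pt k ∧
      a.ax j l = a.ax l j ∧
      a.ax j l = (a.pt j ⊔ a.pt l) ⊓ (a.ax j k ⊔ a.ax k l) := by
  unfold FrameData.IsFrame
  refine forall_congr' fun j => forall_congr' fun k => forall_congr' fun l =>
    forall_congr' fun hjk => forall_congr' fun hkl => forall_congr' fun hjl => ?_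
  have h1 : (Finset.univ.erase j : Finset (Fin 3)) = {k, l} := by revert j k l; decide
  have h2 : (Finset.univ : Finset (Fin 3)) = {j, k, l} := by clear h1; revert j k l; decide
  have h3 : (Finset.univ.erase j).sup a.pt = a.pt k ⊔ a.pt l := by
    rw [h1, Finset.sup_insert, Finset.sup_singleton]
  have h4 : Finset.univ.inf a.pt = a.pt j ⊓ (a.pt k ⊓ a.pt l) := by
    rw [h2, Finset.inf_insert, Finset.inf_insert, Finset.inf_singleton]
  rw [h3, h4]

theorem axisSub_inf_eq_bot {i j l : Fin 3} (hij : i ≠ j) (hjl : j ≠ l) (hil : i ≠ l)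
    {X : Submodule ℚ (Fin 3 × Fin n → ℚ)} (h : ∀ x ∈ X, x ∈ axisSub i → comp i x = 0) :
    axisSub i ⊓ X = ⊥ := by
  rw [eq_bot_iff]
  rintro x ⟨hx, hx'⟩
  have h0 := h x hx' hx
  rw [SetLike.mem_coe, mem_axisSub_iff hij hjl hil] at hx
  exact eq_of_comp hij hjl hil (by simp [h0]) (by simp [hx]) (by simp [hx])

theorem isFrame_canonicalFrame (Φ : PosDefForm (Fin 3 × Fin n)) :
    (canonicalFrame Φ).IsFrame := by
  rw [isFrame_iff]
  intro j k l hjk hkl hjl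
  rw [canonicalFrame_pt, canonicalFrame_pt, canonicalFrame_pt, canonicalFrame_ax _ hjk,
    canonicalFrame_ax _ hjl, canonicalFrame_ax _ hkl, canonicalFrame_ax _ hjl.symm]
  have h0 : (axisSub j ⊓ (axisSub k ⊓ axisSub l) : Submodule ℚ (Fin 3 × Fin n → ℚ)) = ⊥ :=
    axisSub_inf_eq_bot hjk hkl hjl fun x hx _ => hx.1 j hjk
  have h1 : (axisSub j ⊓ (axisSub k ⊔ axisSub l) : Submodule ℚ (Fin 3 × Fin n → ℚ)) = ⊥ :=
    axisSub_inf_eq_bot hjk hkl hjl fun x hx _ =>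
      (mem_axisSub_sup_iff hkl hjl.symm hjk.symm).1 hx
  have h2 : (axisSub j ⊓ graphSub j k 1 : Submodule ℚ (Fin 3 × Fin n → ℚ)) = ⊥ := by
    refine axisSub_inf_eq_bot hjk hkl hjl fun x hx hx' => ?_
    have := hx.1
    rw [hx' k hjk.symm] at this
    exact neg_eq_zero.1 this.symm
  have h3 : (axisSub j ⊔ graphSub j k 1 : Submodule ℚ (Fin 3 × Fin n → ℚ)) =
      axisSub j ⊔ axisSub k := by
    ext x
    rw [mem_axisSub_sup_iff hjk hkl hjl]
    constructor
    · intro h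
      obtain ⟨a, ha, b, hb, rfl⟩ := Submodule.mem_sup.1 h
      rw [map_add, ha l hjl.symm, hb.2 l hjl.symm hkl.symm, add_zero]
    · intro h
      have hx : x = incl j (comp j x + comp k x) + (incl j (- comp k x) + incl k (comp k x)) := by
        apply eq_of_comp hjk hkl hjl <;> simp [comps_incl hjk hkl hjl, h]
      rw [hx]
      refine add_mem (Submodule.mem_sup_left ?_) (Submodule.mem_sup_right ?_)
      · exact fun m hm => comp_incl_of_ne hm _
      · rw [mem_graphSub_iff hjk hkl hjl]
        simp [comps_incl hjk hkl hjl]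
  have h4 : graphSub j l 1 = graphSub l j (1 : Module.End ℚ (Fin n → ℚ)) :=
    graphSub_swap hjl hkl.symm hjk (mul_one 1) (mul_one 1)
  have h5 : (graphSub j l 1 : Submodule ℚ (Fin 3 × Fin n → ℚ)) =
      (axisSub j ⊔ axisSub l) ⊓ (graphSub j k 1 ⊔ graphSub k l 1) := by
    rw [inf_comm, graphSub_mul hjk hkl hjl, mul_one]
  exact ⟨h1.trans h0.symm, h2.trans h0.symm, h3, h4, h5⟩

theorem isOrthogonal_canonicalFrame (d : Fin n → ℚ) (hd : ∀ t, 0 < d t) :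
    (canonicalFrame (blockForm d hd)).IsOrthogonal := by
  intro j k hjk
  rw [canonicalFrame_pt, canonicalFrame_pt]
  intro x hx y hy
  obtain ⟨l, hkl, hjl⟩ : ∃ l : Fin 3, k ≠ l ∧ j ≠ l := by clear hx hy; revert j k; decide
  rw [blockForm_apply_of_ne d hd hjk hkl hjl, hy j hjk, hx k hjk.symm, hx l hjl.symm]
  simp

/-- The subspaces in a subalgebra of one factor, as families indexed by a point. -/
theorem isFrameFamily_of_subMOL (d : Fin n → ℚ) (hd : ∀ t, 0 < d t)
    (T : SubMOL (SubspaceMOL (blockForm d hd)))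
    (hT : (canonicalFrame (blockForm d hd)).elems ⊆ T.carrier) :
    IsFrameFamily (κ := Unit) (fun _ => d) (fun _ => hd) {X | X () ∈ T.carrier} where
  sup_mem hX hY := T.sup_mem hX hY
  inf_mem hX hY := T.inf_mem hX hY
  orthogonal_mem hX := T.compl_mem hX
  axisSub_mem i := by
    rw [Set.mem_ofPred_eq, ← canonicalFrame_pt (blockForm d hd)]
    exact hT (Or.inl ⟨i, rfl⟩)
  graphSub_one_mem i j hij := by
    rw [Set.mem_ofPred_eq, ← canonicalFrame_ax (blockForm d hd) hij]
    exact hT (Or.inr ⟨i, j, hij, rfl⟩)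

theorem isGeneratingOrthogonalFrame_canonicalFrame {d : Fin n → ℚ} (hd : ∀ t, 0 < d t)
    (hinj : Function.Injective d) :
    (canonicalFrame (blockForm d hd)).IsGeneratingOrthogonalFrame :=
  ⟨isFrame_canonicalFrame _, isOrthogonal_canonicalFrame d hd, fun X T hT =>
    (isFrameFamily_of_subMOL d hd T hT).mem_of_unit hinj X⟩

end CanonicalFrame

/-! ### Evaluating matrices over `ℚ(X)` at the nodes -/

section Evaluation

open Filter

/-- The value of a rational function at a rational number. -/
noncomputable def ratEval (a : ℚ) (f : RatFunc ℚ) : ℚ := f.eval (RingHom.id ℚ) a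

theorem eventually_eval_ne_zero {p : Polynomial ℚ} (hp : p ≠ 0) :
    ∀ᶠ m : ℕ in atTop, p.eval (m : ℚ) ≠ 0 :=
  tendsto_natCast_atTop_atTop.eventually (Polynomial.eventually_atTop_not_isRoot p hp)

theorem eventually_eval_denom_ne_zero (f : RatFunc ℚ) :
    ∀ᶠ m : ℕ in atTop, f.denom.eval₂ (RingHom.id ℚ) (m : ℚ) ≠ 0 :=
  eventually_eval_ne_zero f.denom_ne_zero

/-- Evaluation takes junk values at poles, so it respects the operations only away from the zeros of
the denominators. This is why all identities for `act` below hold only for large `k`, depending on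
the matrices. -/
theorem eventually_ratEval_add (f g : RatFunc ℚ) :
    ∀ᶠ m : ℕ in atTop, ratEval m (f + g) = ratEval m f + ratEval m g := by
  filter_upwards [eventually_eval_denom_ne_zero f, eventually_eval_denom_ne_zero g] with m h1 h2
  exact RatFunc.eval_add _ _ h1 h2

theorem eventually_ratEval_mul (f g : RatFunc ℚ) :
    ∀ᶠ m : ℕ in atTop, ratEval m (f * g) = ratEval m f * ratEval m g := by
  filter_upwards [eventually_eval_denom_ne_zero f, eventually_eval_denom_ne_zero g] with m h1 h2
  exact RatFunc.eval_mul _ _ h1 h2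

@[simp] theorem ratEval_zero (a : ℚ) : ratEval a 0 = 0 := RatFunc.eval_zero _ _

@[simp] theorem ratEval_one (a : ℚ) : ratEval a 1 = 1 := RatFunc.eval_one _ _

@[simp] theorem ratEval_X (a : ℚ) : ratEval a RatFunc.X = a := RatFunc.eval_X _ _

@[simp] theorem ratEval_C (a c : ℚ) : ratEval a (RatFunc.C c) = c := RatFunc.eval_C _ _

theorem ratEval_algebraMap (a : ℚ) (p : Polynomial ℚ) :
    ratEval a (algebraMap (Polynomial ℚ) (RatFunc ℚ) p) = p.eval a :=
  RatFunc.eval_algebraMap _ _ p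

theorem eventually_ratEval_ne_zero {f : RatFunc ℚ} (hf : f ≠ 0) :
    ∀ᶠ m : ℕ in atTop, ratEval m f ≠ 0 := by
  filter_upwards [eventually_ratEval_mul f f⁻¹] with m h h0
  rw [mul_inv_cancel₀ hf, h0, zero_mul, ratEval_one] at h
  exact one_ne_zero h

theorem eventually_ratEval_sum (f g : Fin 3 → RatFunc ℚ) :
    ∀ᶠ m : ℕ in atTop, ratEval m (∑ j, f j * g j) = ∑ j, ratEval m (f j) * ratEval m (g j) := by
  filter_upwards [eventually_ratEval_add (f 0 * g 0 + f 1 * g 1) (f 2 * g 2),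
    eventually_ratEval_add (f 0 * g 0) (f 1 * g 1), eventually_ratEval_mul (f 0) (g 0),
    eventually_ratEval_mul (f 1) (g 1), eventually_ratEval_mul (f 2) (g 2)] with m h1 h2 h3 h4 h5
  rw [Fin.sum_univ_three, Fin.sum_univ_three, h1, h2, h3, h4, h5]

/-- The diagonal entries of the second Gram matrix. -/
def node (k : ℕ) (t : Fin (2 ^ k)) : ℚ := ((k + t + 1 : ℕ) : ℚ)

theorem node_pos (k : ℕ) (t : Fin (2 ^ k)) : 0 < node k t := by
  unfold node; positivity

theorem node_injective (k : ℕ) : Function.Injective (node k) := by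
  intro s t h
  have : (k + s + 1 : ℕ) = k + t + 1 := Nat.cast_injective (R := ℚ) h
  exact Fin.ext (by omega)

/-- All nodes of factor `k` exceed `k`, so a property of all large integers holds at all of them at
once. The shift by `k` in `node` serves this purpose. -/
theorem eventually_node {p : ℚ → Prop} (h : ∀ᶠ m : ℕ in atTop, p m) :
    ∀ᶠ k in atTop, ∀ t, p (node k t) := by
  obtain ⟨N, hN⟩ := eventually_atTop.1 h
  filter_upwards [eventually_ge_atTop N] with k hk t
  exact hN _ (by omega)

/-- The action of a matrix of rational functions, evaluated in the diagonal matrix of nodes. -/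
noncomputable def act (k : ℕ) (M : Matrix (Fin 3) (Fin 3) (RatFunc ℚ)) :
    (Fin 3 × Fin (2 ^ k) → ℚ) →ₗ[ℚ] (Fin 3 × Fin (2 ^ k) → ℚ) where
  toFun x p := ∑ j, ratEval (node k p.2) (M p.1 j) * x (j, p.2)
  map_add' x y := by ext p; simp [mul_add, Finset.sum_add_distrib]
  map_smul' c x := by
    ext p
    simp only [Pi.smul_apply, smul_eq_mul, RingHom.id_apply, Finset.mul_sum]
    exact Finset.sum_congr rfl fun j _ => by ring

/-- The vector of the values of three rational functions at the nodes. -/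
noncomputable def vec (k : ℕ) (u : Fin 3 → RatFunc ℚ) : Fin 3 × Fin (2 ^ k) → ℚ :=
  fun p => ratEval (node k p.2) (u p.1)

theorem act_apply (k : ℕ) (M : Matrix (Fin 3) (Fin 3) (RatFunc ℚ))
    (x : Fin 3 × Fin (2 ^ k) → ℚ) (i : Fin 3) (t : Fin (2 ^ k)) :
    act k M x (i, t) = ∑ j, ratEval (node k t) (M i j) * x (j, t) := rfl

theorem act_zero (k : ℕ) (x : Fin 3 × Fin (2 ^ k) → ℚ) : act k 0 x = 0 := by
  ext ⟨i, t⟩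
  simp [act_apply]

theorem act_one (k : ℕ) (x : Fin 3 × Fin (2 ^ k) → ℚ) : act k 1 x = x := by
  ext ⟨i, t⟩
  rw [act_apply, Finset.sum_eq_single i]
  · simp
  · intro j _ hj
    simp [Matrix.one_apply_ne hj.symm]
  · simp

theorem eventually_act_add (M N : Matrix (Fin 3) (Fin 3) (RatFunc ℚ)) :
    ∀ᶠ k in atTop, ∀ x, act k (M + N) x = act k M x + act k N x := by
  have h : ∀ᶠ k in atTop, ∀ i j t, ratEval (node k t) (M i j + N i j) =
      ratEval (node k t) (M i j) + ratEval (node k t) (N i j) := by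
    rw [eventually_all]; intro i
    rw [eventually_all]; intro j
    exact eventually_node (p := fun a => ratEval a (M i j + N i j) =
      ratEval a (M i j) + ratEval a (N i j)) (eventually_ratEval_add _ _)
  filter_upwards [h] with k hk x
  ext ⟨i, t⟩
  simp only [act_apply, Pi.add_apply, Matrix.add_apply, hk, add_mul, Finset.sum_add_distrib]

theorem eventually_act_mul (M N : Matrix (Fin 3) (Fin 3) (RatFunc ℚ)) :
    ∀ᶠ k in atTop, ∀ x, act k (M * N) x = act k M (act k N x) := by
  have h : ∀ᶠ k in atTop, ∀ i j t, ratEval (node k t) (∑ l, M i l * N l j) =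
      ∑ l, ratEval (node k t) (M i l) * ratEval (node k t) (N l j) := by
    rw [eventually_all]; intro i
    rw [eventually_all]; intro j
    exact eventually_node (p := fun a => ratEval a (∑ l, M i l * N l j) =
      ∑ l, ratEval a (M i l) * ratEval a (N l j)) (eventually_ratEval_sum (M i) fun l => N l j)
  filter_upwards [h] with k hk x
  ext ⟨i, t⟩
  simp only [act_apply, Matrix.mul_apply, hk, Finset.sum_mul, Finset.mul_sum]
  rw [Finset.sum_comm]
  exact Finset.sum_congr rfl fun _ _ => Finset.sum_congr rfl fun _ _ => mul_assoc _ _ _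

theorem eventually_act_vec (M : Matrix (Fin 3) (Fin 3) (RatFunc ℚ)) (u : Fin 3 → RatFunc ℚ) :
    ∀ᶠ k in atTop, act k M (vec k u) = vec k (M.mulVec u) := by
  have h : ∀ᶠ k in atTop, ∀ i t, ratEval (node k t) (∑ l, M i l * u l) =
      ∑ l, ratEval (node k t) (M i l) * ratEval (node k t) (u l) := by
    rw [eventually_all]; intro i
    exact eventually_node (p := fun a => ratEval a (∑ l, M i l * u l) =
      ∑ l, ratEval a (M i l) * ratEval a (u l)) (eventually_ratEval_sum (M i) u)
  filter_upwards [h] with k hk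
  ext ⟨i, t⟩
  simp only [act_apply, vec, Matrix.mulVec, dotProduct, hk]

theorem act_dotProduct (k : ℕ) (M : Matrix (Fin 3) (Fin 3) (RatFunc ℚ))
    (x y : Fin 3 × Fin (2 ^ k) → ℚ) :
    act k M x ⬝ᵥ y = x ⬝ᵥ act k M.transpose y := by
  simp only [dotProduct, Fintype.sum_prod_type_right, act_apply, Matrix.transpose_apply,
    Finset.sum_mul, Finset.mul_sum]
  refine Finset.sum_congr rfl fun t _ => ?_
  rw [Finset.sum_comm]
  exact Finset.sum_congr rfl fun _ _ => Finset.sum_congr rfl fun _ _ => by ring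

/-- The standard positive definite form. -/
def stdForm (ι : Type*) [Fintype ι] : PosDefForm ι where
  form := LinearMap.mk₂ ℚ (fun x y => x ⬝ᵥ y)
    (fun x x' y => add_dotProduct x x' y) (fun c x y => smul_dotProduct c x y)
    (fun x y y' => dotProduct_add x y y') (fun c x y => dotProduct_smul c x y)
  symm x y := by
    simp only [LinearMap.mk₂_apply]
    exact dotProduct_comm x y
  pos x hx := by
    rw [LinearMap.mk₂_apply]
    exact lt_of_le_of_ne (Finset.sum_nonneg fun i _ => mul_self_nonneg (x i))
      fun h => hx (dotProduct_self_eq_zero.1 h.symm)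

/-- The orthogonal of `F ⊓ Wᗮ` is contained in `Fᗮ ⊔ W`. -/
theorem exists_sub_orthogonal {ι : Type*} [Fintype ι] (F W : Submodule ℚ (ι → ℚ)) {g : ι → ℚ}
    (hg : ∀ z ∈ F, (∀ w ∈ W, w ⬝ᵥ z = 0) → z ⬝ᵥ g = 0) :
    ∃ w ∈ W, ∀ z ∈ F, z ⬝ᵥ (g - w) = 0 := by
  set B := (stdForm ι).form
  -- The orthogonal of `Fᗮ ⊔ W` is `F ⊓ Wᗮ`, to which `g` is orthogonal; in finite dimension the
  -- double orthogonal is the subspace itself.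
  have hmem : g ∈ B.orthogonal (B.orthogonal (B.orthogonal F ⊔ W)) := by
    intro z hz
    refine hg z ?_ fun w hw => hz w (Submodule.mem_sup_right hw)
    rw [← (stdForm ι).orthogonal_orthogonal F]
    exact fun f hf => hz f (Submodule.mem_sup_left hf)
  rw [(stdForm ι).orthogonal_orthogonal] at hmem
  obtain ⟨a, ha, w, hw, rfl⟩ := Submodule.mem_sup.1 hmem
  exact ⟨w, hw, fun z hz => by rw [add_sub_cancel_right]; exact ha z hz⟩

/-- The sum of the ranges of two idempotent matrices is the range of an idempotent matrix. -/
theorem exists_matrix_sup {K : Type*} [Field K] {m : Type*} [Fintype m] [DecidableEq m]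
    (M N : Matrix m m K) : ∃ P A B : Matrix m m K, P * M = M ∧ P * N = N ∧ P = M * A + N * B := by
  set f := Matrix.toLin' M
  set g := Matrix.toLin' N
  set h := f.coprod g
  -- `p` projects onto the sum of the two ranges. Lifting it through `h` to `q` writes it as `M * A
  -- + N * B`.
  obtain ⟨p, hp⟩ := LinearMap.exists_leftInverse_of_injective (LinearMap.range h).subtype
    (Submodule.ker_subtype _)
  obtain ⟨q, hq⟩ := Module.projective_lifting_property h.rangeRestrict p
    h.surjective_rangeRestrict
  have hp' : ∀ x ∈ LinearMap.range h, (p x : m → K) = x := fun x hx =>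
    congrArg Subtype.val (LinearMap.congr_fun hp ⟨x, hx⟩)
  have hq' : ∀ x, f (q x).1 + g (q x).2 = p x := fun x =>
    congrArg Subtype.val (LinearMap.congr_fun hq x)
  refine ⟨LinearMap.toMatrix' ((LinearMap.range h).subtype.comp p),
    LinearMap.toMatrix' ((LinearMap.fst K _ _).comp q),
    LinearMap.toMatrix' ((LinearMap.snd K _ _).comp q), ?_, ?_, ?_⟩
  · apply Matrix.toLin'.injective
    rw [Matrix.toLin'_mul, Matrix.toLin'_toMatrix']
    exact LinearMap.ext fun x => hp' _ ⟨(x, 0), by simp [h, f]⟩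
  · apply Matrix.toLin'.injective
    rw [Matrix.toLin'_mul, Matrix.toLin'_toMatrix']
    exact LinearMap.ext fun x => hp' _ ⟨(0, x), by simp [h, g]⟩
  · apply Matrix.toLin'.injective
    rw [map_add, Matrix.toLin'_mul, Matrix.toLin'_mul, Matrix.toLin'_toMatrix',
      Matrix.toLin'_toMatrix', Matrix.toLin'_toMatrix']
    exact LinearMap.ext fun x => (hq' x).symm

end Evaluation

/-! ### Families sandwiched around the range of an idempotent over `ℚ(X)` -/

section Sandwich

open Filter

/-- The form on `ℚ^(3 * 2^k)`. -/
def nodeForm (k : ℕ) : PosDefForm (Fin 3 × Fin (2 ^ k)) := blockForm (node k) (node_pos k)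

/-- The diagonal matrix with entries `1, X, 1`. -/
noncomputable def gramMatrix : Matrix (Fin 3) (Fin 3) (RatFunc ℚ) :=
  Matrix.diagonal ![1, RatFunc.X, 1]

/-- The inverse of `gramMatrix`. -/
noncomputable def gramInv : Matrix (Fin 3) (Fin 3) (RatFunc ℚ) :=
  Matrix.diagonal ![1, RatFunc.X⁻¹, 1]

theorem gramMatrix_mul_gramInv : gramMatrix * gramInv = 1 := by
  rw [gramMatrix, gramInv, Matrix.diagonal_mul_diagonal, ← Matrix.diagonal_one]
  congr 1
  ext i
  fin_cases i <;> simp [RatFunc.X_ne_zero]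

theorem gramInv_mul_gramMatrix : gramInv * gramMatrix = 1 := by
  rw [gramMatrix, gramInv, Matrix.diagonal_mul_diagonal, ← Matrix.diagonal_one]
  congr 1
  ext i
  fin_cases i <;> simp [RatFunc.X_ne_zero]

theorem gramMatrix_transpose : gramMatrix.transpose = gramMatrix := Matrix.diagonal_transpose _

/-- The constant vector `(0, 0, 1)`. -/
noncomputable def lastVec : Fin 3 → RatFunc ℚ := ![0, 0, 1]

theorem dotProduct_eq_sum_comp {n : ℕ} (x y : Fin 3 × Fin n → ℚ) :
    x ⬝ᵥ y = ∑ i, comp i x ⬝ᵥ comp i y := Fintype.sum_prod_type _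

theorem act_gramMatrix_apply (k : ℕ) (y : Fin 3 × Fin (2 ^ k) → ℚ) (i : Fin 3)
    (t : Fin (2 ^ k)) :
    act k gramMatrix y (i, t) =
      ratEval (node k t) ((![1, RatFunc.X, 1] : Fin 3 → RatFunc ℚ) i) * y (i, t) := by
  rw [act_apply, Finset.sum_eq_single i]
  · rw [gramMatrix, Matrix.diagonal_apply_eq]
  · intro j _ hj
    rw [gramMatrix, Matrix.diagonal_apply_ne _ hj.symm, ratEval_zero, zero_mul]
  · simp

theorem vec_lastVec_dotProduct (k : ℕ) (y : Fin 3 × Fin (2 ^ k) → ℚ) :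
    vec k lastVec ⬝ᵥ y = ∑ t, y (2, t) := by
  rw [dotProduct, Fintype.sum_prod_type, Fin.sum_univ_three]
  simp [vec, lastVec]

/-- Since `J` has rank one, the Gram matrix is `diag(1, X, 1)` evaluated at the nodes, plus a
rank-one term. That term only adds `lastVec` to the finite sets of exceptional vectors. -/
theorem nodeForm_apply (k : ℕ) (x y : Fin 3 × Fin (2 ^ k) → ℚ) :
    (nodeForm k).form x y =
      x ⬝ᵥ (act k gramMatrix y + (vec k lastVec ⬝ᵥ y) • vec k lastVec) := by
  rw [dotProduct_eq_sum_comp, nodeForm, blockForm_apply, vec_lastVec_dotProduct]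
  refine Finset.sum_congr rfl fun i _ => ?_
  congr 1
  ext t
  rw [comp_apply, Pi.add_apply, act_gramMatrix_apply, Pi.smul_apply]
  fin_cases i <;> simp [block, vec, lastVec, comp_apply, onesEnd_apply]

/-- A family of subspaces that differs from the family of ranges of an idempotent matrix over
`ℚ(X)` only by the values of finitely many vectors of rational functions. -/
def IsSandwiched (l : Filter ℕ) (X : ∀ k, Submodule ℚ (Fin 3 × Fin (2 ^ k) → ℚ)) : Prop :=
  ∃ (M : Matrix (Fin 3) (Fin 3) (RatFunc ℚ)) (s : Set (Fin 3 → RatFunc ℚ)),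
    M * M = M ∧ s.Finite ∧ ∀ᶠ k in l,
      -- The lower bound is the range cut by the conditions from `s`, the upper bound the range plus
      -- the span of `s`. Orthogonality here is for the dot product, not for `nodeForm`.
      (∀ x, act k M x = x → (∀ u ∈ s, vec k u ⬝ᵥ x = 0) → x ∈ X k) ∧
      ∀ x ∈ X k, ∃ w ∈ Submodule.span ℚ (vec k '' s), act k M (x - w) = x - w

theorem dotProduct_eq_zero_of_mem_span {ι : Type*} [Fintype ι] {s : Set (ι → ℚ)} {x w : ι → ℚ}
    (h : ∀ u ∈ s, u ⬝ᵥ x = 0) (hw : w ∈ Submodule.span ℚ s) : w ⬝ᵥ x = 0 := by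
  induction hw using Submodule.span_induction with
  | mem u hu => exact h u hu
  | zero => exact zero_dotProduct x
  | add u v _ _ hu hv => rw [add_dotProduct, hu, hv, add_zero]
  | smul c u _ hu => rw [smul_dotProduct, hu, smul_zero]

theorem eventually_act_vec_of_finite {l : Filter ℕ} (hl : l ≤ atTop)
    (M : Matrix (Fin 3) (Fin 3) (RatFunc ℚ)) {s : Set (Fin 3 → RatFunc ℚ)} (hs : s.Finite) :
    ∀ᶠ k in l, ∀ u ∈ s, act k M (vec k u) = vec k (M.mulVec u) :=
  (eventually_all_finite hs).2 fun u _ => hl (eventually_act_vec M u)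

/-- Sandwiched families are closed under joins. -/
theorem IsSandwiched.sup {l : Filter ℕ} (hl : l ≤ atTop)
    {X Y : ∀ k, Submodule ℚ (Fin 3 × Fin (2 ^ k) → ℚ)} (hX : IsSandwiched l X)
    (hY : IsSandwiched l Y) : IsSandwiched l fun k => X k ⊔ Y k := by
  obtain ⟨M, s, hM, hs, h⟩ := hX
  obtain ⟨N, r, hN, hr, h'⟩ := hY
  obtain ⟨P, A, B, hPM, hPN, hP⟩ := exists_matrix_sup M N
  have hPP : P * P = P := by
    nth_rw 2 [hP]
    rw [mul_add, ← mul_assoc, ← mul_assoc, hPM, hPN, ← hP]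
  -- The sets `s` and `r` serve the upper bound. For the lower bound, `x` splits as `MA x + NB x`,
  -- and conditions on the summands become conditions on `x` through the transposes.
  refine ⟨P, (s ∪ r) ∪ ((M * A).transpose.mulVec '' s ∪ (N * B).transpose.mulVec '' r), hPP,
    (hs.union hr).union ((hs.image _).union (hr.image _)), ?_⟩
  have hMA : M * (M * A) = M * A := by rw [← mul_assoc, hM]
  have hNB : N * (N * B) = N * B := by rw [← mul_assoc, hN]
  filter_upwards [h, h', hl (eventually_act_add (M * A) (N * B)),
    hl (eventually_act_mul M (M * A)), hl (eventually_act_mul N (N * B)),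
    hl (eventually_act_mul P M), hl (eventually_act_mul P N),
    eventually_act_vec_of_finite hl (M * A).transpose hs,
    eventually_act_vec_of_finite hl (N * B).transpose hr] with k hX hY hadd hMM hNN hPM' hPN' h1 h2
  rw [← hP] at hadd
  rw [hMA] at hMM
  rw [hNB] at hNN
  rw [hPM] at hPM'
  rw [hPN] at hPN'
  constructor
  · intro x hx hxs
    rw [← hx, hadd]
    refine add_mem (Submodule.mem_sup_left (hX.1 _ (hMM x).symm fun u hu => ?_))
      (Submodule.mem_sup_right (hY.1 _ (hNN x).symm fun u hu => ?_))
    · rw [← Matrix.transpose_transpose (M * A), ← act_dotProduct, h1 u hu]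
      exact hxs _ (Or.inr (Or.inl ⟨u, hu, rfl⟩))
    · rw [← Matrix.transpose_transpose (N * B), ← act_dotProduct, h2 u hu]
      exact hxs _ (Or.inr (Or.inr ⟨u, hu, rfl⟩))
  · intro x hx
    obtain ⟨y, hy, z, hz, rfl⟩ := Submodule.mem_sup.1 hx
    obtain ⟨v, hv, hv'⟩ := hX.2 y hy
    obtain ⟨w, hw, hw'⟩ := hY.2 z hz
    refine ⟨v + w, add_mem ?_ ?_, ?_⟩
    · exact Submodule.span_mono (Set.image_mono (Set.subset_union_left.trans
        Set.subset_union_left)) hv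
    · exact Submodule.span_mono (Set.image_mono (Set.subset_union_right.trans
        Set.subset_union_left)) hw
    · rw [add_sub_add_comm, map_add, ← hv', ← hw', ← hPM', ← hPN']

/-- Sandwiched families are closed under orthocomplements. -/
theorem IsSandwiched.orthogonal {l : Filter ℕ} (hl : l ≤ atTop)
    {X : ∀ k, Submodule ℚ (Fin 3 × Fin (2 ^ k) → ℚ)} (hX : IsSandwiched l X) :
    IsSandwiched l fun k => (nodeForm k).form.orthogonal (X k) := by
  obtain ⟨M, s, hM, hs, h⟩ := hX
  -- With `E = gramMatrix`, and up to the rank-one term, `x` is orthogonal to `X k` when `E x` is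
  -- dot-orthogonal to it, so roughly when `E x` lies in the kernel of `Mᵀ`, the range of `N`. Hence
  -- the new idempotent is `E⁻¹ N E`.
  set N := 1 - M.transpose with hN
  have hMN : M.transpose * N = 0 := by
    rw [hN, mul_sub, mul_one, ← Matrix.transpose_mul, hM, sub_self]
  have hNN : N * N = N := by
    nth_rw 1 [hN]
    rw [sub_mul, one_mul, hMN, sub_zero]
  have hadd : N + M.transpose = 1 := sub_add_cancel _ _
  -- The first part collects the errors of the upper bound, carried back by `E⁻¹`. The second holds
  -- the conditions for the lower bound: `lastVec` kills the rank-one term, and `E s` handles the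
  -- error of `X k`.
  set s' := gramInv.mulVec '' (s ∪ {lastVec}) ∪ ({lastVec} ∪ gramMatrix.mulVec '' s)
  have hsl : (s ∪ {lastVec}).Finite := hs.union (Set.finite_singleton _)
  have hEM : gramMatrix * (gramInv * N * gramMatrix) = N * gramMatrix := by
    rw [← mul_assoc, ← mul_assoc, gramMatrix_mul_gramInv, one_mul]
  have hMI : gramInv * N * gramMatrix * gramInv = gramInv * N := by
    rw [mul_assoc, gramMatrix_mul_gramInv, mul_one]
  refine ⟨gramInv * N * gramMatrix, s', ?_, (hsl.image _).union
    ((Set.finite_singleton _).union (hs.image _)), ?_⟩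
  · rw [mul_assoc (gramInv * N), hEM, ← mul_assoc, mul_assoc gramInv, hNN]
  filter_upwards [h, hl (eventually_act_mul gramMatrix (gramInv * N * gramMatrix)),
    hl (eventually_act_mul N gramMatrix), hl (eventually_act_mul M.transpose N),
    hl (eventually_act_mul (gramInv * N * gramMatrix) gramInv), hl (eventually_act_mul gramInv N),
    hl (eventually_act_mul gramInv gramMatrix), hl (eventually_act_mul M M),
    hl (eventually_act_add N M.transpose),
    eventually_act_vec_of_finite hl gramInv hsl, eventually_act_vec_of_finite hl gramMatrix hs]
    with k hX hE hNE hMN' hI hIN hIE hMM hNM hvI hvE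
  rw [hEM] at hE
  rw [hMN] at hMN'
  rw [hMI] at hI
  rw [gramInv_mul_gramMatrix] at hIE
  rw [hM] at hMM
  rw [hadd] at hNM
  constructor
  · intro x hx hxs y hy
    obtain ⟨w, hw, hw'⟩ := hX.2 y hy
    have hlast : vec k lastVec ⬝ᵥ x = 0 := hxs _ (Or.inr (Or.inl rfl))
    have ha : act k M.transpose (act k gramMatrix x) = 0 := by
      rw [← hx, ← hE, hNE, ← hMN', act_zero]
    rw [nodeForm_apply, hlast, zero_smul, add_zero]
    have hy' : y = act k M (y - w) + w := by rw [hw', sub_add_cancel]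
    rw [hy', add_dotProduct, act_dotProduct, ha, dotProduct_zero, zero_add]
    refine dotProduct_eq_zero_of_mem_span ?_ hw
    rintro _ ⟨u, hu, rfl⟩
    rw [← gramMatrix_transpose, ← act_dotProduct, hvE u hu]
    exact hxs _ (Or.inr (Or.inr ⟨u, hu, rfl⟩))
  · intro x hx
    set g := act k gramMatrix x + (vec k lastVec ⬝ᵥ x) • vec k lastVec with hg
    have hgX : ∀ y ∈ X k, y ⬝ᵥ g = 0 := fun y hy => by
      rw [hg, ← nodeForm_apply]
      exact hx y hy
    -- Dualizing the lower bound for `X k`: up to the span of `s`, `g` is orthogonal to the range of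
    -- `M`.
    obtain ⟨w, hw, hw'⟩ := exists_sub_orthogonal
      (LinearMap.ker (act k M - LinearMap.id)) (Submodule.span ℚ (vec k '' s)) (g := g) (by
        intro z hz hz'
        exact hgX z (hX.1 z (by rwa [LinearMap.mem_ker, LinearMap.sub_apply, LinearMap.id_apply,
          sub_eq_zero] at hz) fun u hu => hz' _ (Submodule.subset_span ⟨u, hu, rfl⟩)))
    have ha : act k M.transpose (g - w) = 0 := by
      refine dotProduct_eq_zero _ fun z => ?_
      rw [act_dotProduct, Matrix.transpose_transpose, dotProduct_comm]
      exact hw' _ (by rw [LinearMap.mem_ker, LinearMap.sub_apply, LinearMap.id_apply, ← hMM,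
        sub_self])
    have hNa : act k N (g - w) = g - w := by
      have := hNM (g - w)
      rw [ha, add_zero, act_one] at this
      exact this.symm
    set c := vec k lastVec ⬝ᵥ x
    refine ⟨act k gramInv (w - c • vec k lastVec), ?_, ?_⟩
    · have hmem : ∀ v ∈ Submodule.span ℚ (vec k '' (s ∪ {lastVec})),
          act k gramInv v ∈ Submodule.span ℚ (vec k '' s') := by
        intro v hv
        rw [← Submodule.mem_comap]
        refine (Submodule.span_le.2 ?_) hv
        rintro _ ⟨u, hu, rfl⟩
        rw [SetLike.mem_coe, Submodule.mem_comap, hvI u hu]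
        exact Submodule.subset_span ⟨_, Or.inl ⟨u, hu, rfl⟩, rfl⟩
      refine hmem _ (sub_mem (Submodule.span_mono (Set.image_mono Set.subset_union_left) hw)
        (Submodule.smul_mem _ _ (Submodule.subset_span ⟨_, Or.inr rfl, rfl⟩)))
    · have hxa : x - act k gramInv (w - c • vec k lastVec) = act k gramInv (g - w) := by
        have : g - w = act k gramMatrix x - (w - c • vec k lastVec) := by
          rw [hg]; abel
        rw [this, map_sub _ (act k gramMatrix x), ← hIE, act_one]
      rw [hxa, ← hI, hIN, hNa]

/-- A constant matrix evaluates without poles, so both bounds are exact and no exceptional vectors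
are needed. -/
theorem isSandwiched_of_idempotent (l : Filter ℕ) {N : Matrix (Fin 3) (Fin 3) ℚ} (hN : N * N = N)
    {X : ∀ k, Submodule ℚ (Fin 3 × Fin (2 ^ k) → ℚ)}
    (hX : ∀ k x, x ∈ X k ↔ ∀ i, ∑ j, N i j • comp j x = comp i x) : IsSandwiched l X := by
  have h : ∀ k (x : Fin 3 × Fin (2 ^ k) → ℚ), act k (N.map RatFunc.C) x = x ↔ x ∈ X k := by
    intro k x
    have : ∀ i t, act k (N.map RatFunc.C) x (i, t) = (∑ j, N i j • comp j x) t := by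
      intro i t
      simp only [act_apply, Finset.sum_apply, comp_apply, Matrix.map_apply, ratEval_C,
        Pi.smul_apply, smul_eq_mul]
    rw [hX]
    constructor
    · intro h i
      ext t
      rw [← this, h]
      rfl
    · intro h
      ext ⟨i, t⟩
      rw [this, h]
      rfl
  refine ⟨N.map RatFunc.C, ∅, ?_, Set.finite_empty, Eventually.of_forall fun k =>
    ⟨fun x hx _ => (h k x).1 hx, fun x hx => ⟨0, zero_mem _, ?_⟩⟩⟩
  · rw [← Matrix.map_mul, hN]
  · rw [sub_zero]
    exact (h k x).2 hx

theorem isSandwiched_bot (l : Filter ℕ) : IsSandwiched l fun _ => ⊥ := by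
  refine isSandwiched_of_idempotent l (N := 0) (mul_zero 0) fun k x => ?_
  simp only [Matrix.zero_apply, zero_smul, Finset.sum_const_zero, Submodule.mem_bot]
  exact ⟨fun h i => by rw [h, map_zero], fun h => eq_of_comp (i := 0) (j := 1) (l := 2)
    (by decide) (by decide) (by decide) (by rw [← h, map_zero]) (by rw [← h, map_zero])
    (by rw [← h, map_zero])⟩

theorem isSandwiched_axisSub (l : Filter ℕ) (i : Fin 3) :
    IsSandwiched l fun _ => axisSub i := by
  refine isSandwiched_of_idempotent l (N := Matrix.single i i 1) (by simp) fun k x => ?_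
  have h : ∀ m, ∑ j, (Matrix.single i i (1 : ℚ)) m j • comp j x =
      if m = i then comp i x else 0 := by
    intro m
    by_cases hm : m = i
    · subst hm
      simp [Matrix.single_apply]
    · simp [hm, Ne.symm hm]
  simp only [h]
  constructor
  · intro hx m
    split_ifs with hm
    · rw [hm]
    · exact (hx m hm).symm
  · intro hx m hm
    rw [← hx, if_neg hm]

theorem isSandwiched_graphSub_one (l : Filter ℕ) {i j : Fin 3} (hij : i ≠ j) :
    IsSandwiched l fun _ => graphSub i j 1 := by
  -- This idempotent keeps the `i`-th component, puts its negative at `j`, and forgets the rest.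
  refine isSandwiched_of_idempotent l (N := Matrix.single i i 1 - Matrix.single j i 1)
    (by simp [sub_mul, mul_sub, hij]) fun k x => ?_
  have h : ∀ m, ∑ q, (Matrix.single i i (1 : ℚ) - Matrix.single j i 1 : Matrix _ _ ℚ) m q • comp q x =
      (if m = i then comp i x else 0) - if m = j then comp i x else 0 := by
    intro m
    simp only [Matrix.sub_apply, sub_smul, Finset.sum_sub_distrib]
    congr 1
    · by_cases hm : m = i
      · subst hm
        simp [Matrix.single_apply]
      · simp [hm, Ne.symm hm]
    · by_cases hm : m = j
      · subst hm
        simp [Matrix.single_apply]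
      · simp [hm, Ne.symm hm]
  simp only [h]
  constructor
  · intro hx m
    by_cases hm : m = i
    · subst hm
      simp [hij]
    · by_cases hm' : m = j
      · subst hm'
        simp [hm, hx.1]
      · simp [hm, hm', hx.2 m hm hm']
  · intro hx
    refine ⟨?_, fun m hm hm' => ?_⟩
    · rw [← hx j]
      simp [hij.symm]
    · rw [← hx m]
      simp [hm, hm']

end Sandwich

/-! ### A sandwiched family orthogonal to all `Dʲv` vanishes -/

section Faithful

open Filter

variable {l : Filter ℕ} {X : ∀ k, Submodule ℚ (Fin 3 × Fin (2 ^ k) → ℚ)}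

/-- The exponent `j + 1` makes the three summands uniform, as the block `D` supplies one factor by
itself. -/
theorem eventually_sum_pow_mul_eq_zero
    (hq : ∀ i j, ∀ᶠ k in l, ∀ x ∈ X k, (nodeForm k).form (incl i (node k ^ j)) x = 0)
    (i : Fin 3) (j : ℕ) :
    ∀ᶠ k in l, ∀ x ∈ X k, ∑ t, node k t ^ (j + 1) * x (i, t) = 0 := by
  fin_cases i
  · filter_upwards [hq 0 (j + 1)] with k h x hx
    have := h x hx
    rwa [nodeForm, blockForm_incl_left] at this
  · filter_upwards [hq 1 j] with k h x hx
    have := h x hx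
    rw [nodeForm, blockForm_incl_left] at this
    refine Eq.trans (Finset.sum_congr rfl fun t _ => ?_) this
    simp [block, comp_apply, pow_succ, mul_assoc]
  · have h2 : ∀ k m (x : Fin 3 × Fin (2 ^ k) → ℚ), (nodeForm k).form (incl 2 (node k ^ m)) x =
        ∑ t, node k t ^ m * x (2, t) + (∑ t, node k t ^ m) * ∑ t, x (2, t) := by
      intro k m x
      rw [nodeForm, blockForm_incl_left]
      change _ ⬝ᵥ (comp 2 x + onesEnd (comp 2 x)) = _
      rw [dotProduct_add, dotProduct_onesEnd]
      rfl
    -- Exponent `0` gives `(1 + 2^k) ∑ x = 0`; so the contribution of `J` vanishes for the other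
    -- exponents too.
    filter_upwards [hq 2 0, hq 2 (j + 1)] with k h h' x hx
    have h0 := h x hx
    have h1 := h' x hx
    rw [h2] at h0 h1
    simp only [pow_zero, one_mul, Finset.sum_const, Finset.card_univ, Fintype.card_fin,
      nsmul_eq_mul, mul_one] at h0
    have h3 : ∑ t, x (2, t) = 0 := by
      rw [← one_add_mul] at h0
      exact (mul_eq_zero.1 h0).resolve_left (by positivity)
    rw [h3, mul_zero, add_zero] at h1
    exact h1

theorem eventually_sum_eval_mul_eq_zero
    (hq : ∀ i j, ∀ᶠ k in l, ∀ x ∈ X k, (nodeForm k).form (incl i (node k ^ j)) x = 0)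
    (i : Fin 3) (p : Polynomial ℚ) :
    ∀ᶠ k in l, ∀ x ∈ X k, ∑ t, node k t * p.eval (node k t) * x (i, t) = 0 := by
  have h : ∀ᶠ k in l, ∀ j ∈ Finset.range (p.natDegree + 1), ∀ x ∈ X k,
      ∑ t, node k t ^ (j + 1) * x (i, t) = 0 :=
    (eventually_all_finset _).2 fun j _ => eventually_sum_pow_mul_eq_zero hq i j
  filter_upwards [h] with k h x hx
  calc ∑ t, node k t * p.eval (node k t) * x (i, t)
      = ∑ t, ∑ j ∈ Finset.range (p.natDegree + 1),
          p.coeff j * (node k t ^ (j + 1) * x (i, t)) := by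
        refine Finset.sum_congr rfl fun t _ => ?_
        rw [Polynomial.eval_eq_sum_range, Finset.mul_sum, Finset.sum_mul]
        exact Finset.sum_congr rfl fun j _ => by ring
    _ = ∑ j ∈ Finset.range (p.natDegree + 1),
          p.coeff j * ∑ t, node k t ^ (j + 1) * x (i, t) := by
        rw [Finset.sum_comm]
        simp only [Finset.mul_sum]
    _ = 0 := Finset.sum_eq_zero fun j hj => by rw [h j hj x hx, mul_zero]

theorem act_incl (k : ℕ) (M : Matrix (Fin 3) (Fin 3) (RatFunc ℚ)) (b i : Fin 3)
    (h : Fin (2 ^ k) → ℚ) (t : Fin (2 ^ k)) :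
    act k M (incl b h) (i, t) = ratEval (node k t) (M i b) * h t := by
  rw [act_apply, Finset.sum_eq_single b]
  · simp [incl]
  · intro j _ hj
    simp [incl, hj]
  · simp

/-- A family of subspaces containing, up to boundedly many linear conditions, the range of a nonzero
idempotent matrix of rational functions is not orthogonal to all `Dʲv`. -/
theorem eventually_false_of_ne_zero (hl : l ≤ atTop)
    {M : Matrix (Fin 3) (Fin 3) (RatFunc ℚ)} (hM : M * M = M) (hM0 : M ≠ 0)
    {s : Set (Fin 3 → RatFunc ℚ)} (hs : s.Finite)
    (h : ∀ᶠ k in l, ∀ x, act k M x = x → (∀ u ∈ s, vec k u ⬝ᵥ x = 0) → x ∈ X k)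
    (hq : ∀ i j, ∀ᶠ k in l, ∀ x ∈ X k, ∑ t, node k t ^ (j + 1) * x (i, t) = 0) :
    ∀ᶠ _ in l, False := by
  obtain ⟨a, b, hab⟩ : ∃ a b, M a b ≠ 0 := by
    by_contra! hcon
    exact hM0 (Matrix.ext hcon)
  have := hs.fintype
  set N := Fintype.card s
  have hpow : ∀ᶠ k in l, ∀ j ∈ Finset.range (N + 1), ∀ x ∈ X k,
      ∑ t, node k t ^ (j + 1) * x (a, t) = 0 :=
    (eventually_all_finset _).2 fun j _ => hq a j
  filter_upwards [h, hpow, hl (eventually_act_mul M M), hl (eventually_ge_atTop N),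
    hl (eventually_node (p := fun q => ratEval q (M a b) ≠ 0) (eventually_ratEval_ne_zero hab))]
    with k h hpow hMM hk hne
  rw [hM] at hMM
  let H : (Fin (N + 1) → ℚ) →ₗ[ℚ] (Fin (2 ^ k) → ℚ) :=
    { toFun := fun c t => ratEval (node k t) (M a b) * ∑ j, c j * node k t ^ (j.1 + 1)
      map_add' := fun c c' => by ext t; simp [add_mul, mul_add, Finset.sum_add_distrib]
      map_smul' := fun q c => by
        ext t
        simp only [Pi.smul_apply, smul_eq_mul, RingHom.id_apply, Finset.mul_sum]
        exact Finset.sum_congr rfl fun j _ => by ring }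
  -- `G` records the conditions from `s`. There are `N` of them on `N + 1` coefficients, so a
  -- nonzero `c` satisfies all.
  let G : (Fin (N + 1) → ℚ) →ₗ[ℚ] (s → ℚ) :=
    { toFun := fun c u => vec k u.1 ⬝ᵥ act k M (incl b (H c))
      map_add' := fun c c' => by ext u; simp [dotProduct_add]
      map_smul' := fun q c => by ext u; simp }
  have hG : LinearMap.ker G ≠ ⊥ := LinearMap.ker_ne_bot_of_finrank_lt (by simp [N])
  obtain ⟨c, hc, hc0⟩ := Submodule.exists_mem_ne_zero_of_ne_bot hG
  have hx := h (act k M (incl b (H c))) (hMM _).symm fun u hu =>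
    congrFun (LinearMap.mem_ker.1 hc) ⟨u, hu⟩
  -- Component `a` of the resulting vector of `X k` is `M a b` times `H c`, and `H c` is `M a b`
  -- times a polynomial without constant term. Orthogonality to powers of the nodes makes the norm
  -- of `H c` zero.
  have hsum : ∑ t, H c t * H c t = 0 := by
    calc ∑ t, H c t * H c t
        = ∑ t, ∑ j : Fin (N + 1),
            c j * (node k t ^ (j.1 + 1) * act k M (incl b (H c)) (a, t)) := by
          refine Finset.sum_congr rfl fun t _ => ?_
          rw [act_incl]
          have : H c t = ratEval (node k t) (M a b) * ∑ j, c j * node k t ^ (j.1 + 1) := rfl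
          nth_rw 1 [this]
          rw [Finset.mul_sum, Finset.sum_mul]
          exact Finset.sum_congr rfl fun j _ => by ring
      _ = ∑ j : Fin (N + 1), c j *
            ∑ t, node k t ^ (j.1 + 1) * act k M (incl b (H c)) (a, t) := by
          rw [Finset.sum_comm]
          simp only [Finset.mul_sum]
      _ = 0 := Finset.sum_eq_zero fun j _ => by
          rw [hpow j.1 (Finset.mem_range.2 j.2) _ hx, mul_zero]
  have hH : ∀ t, ∑ j, c j * node k t ^ (j.1 + 1) = 0 := by
    intro t
    have h0 := (Finset.sum_eq_zero_iff_of_nonneg fun t _ => mul_self_nonneg (H c t)).1 hsum t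
      (Finset.mem_univ t)
    exact (mul_eq_zero.1 (mul_self_eq_zero.1 h0)).resolve_left (hne t)
  have hle : N + 1 ≤ 2 ^ k := hk.trans_lt Nat.lt_two_pow_self
  -- Vandermonde: there are at least `N + 1` distinct nodes, and the extra factor of each node is
  -- nonzero.
  refine hc0 (Matrix.eq_zero_of_forall_index_sum_mul_pow_eq_zero
    (f := fun j => node k (Fin.castLE hle j))
    ((node_injective k).comp (Fin.castLE_injective hle)) fun i => ?_)
  have hi := hH (Fin.castLE hle i)
  simp only [pow_succ, ← mul_assoc, ← Finset.sum_mul] at hi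
  exact (mul_eq_zero.1 hi).resolve_right (node_pos k _).ne'

theorem exists_common_denominator {s : Set (Fin 3 → RatFunc ℚ)} (hs : s.Finite) :
    ∃ g : Polynomial ℚ, g ≠ 0 ∧ ∀ u ∈ s, ∀ i, ∃ p : Polynomial ℚ,
      algebraMap _ (RatFunc ℚ) g * u i = algebraMap _ _ p := by
  obtain ⟨b, hb⟩ := IsLocalization.exist_integer_multiples (nonZeroDivisors (Polynomial ℚ))
    (hs.toFinset ×ˢ (Finset.univ : Finset (Fin 3))) fun q => (q.1 q.2 : RatFunc ℚ)
  refine ⟨b, nonZeroDivisors.coe_ne_zero b, fun u hu i => ?_⟩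
  obtain ⟨p, hp⟩ := hb (u, i) (by simp [hu])
  exact ⟨p, by rw [hp, Algebra.smul_def]⟩

/-- A family of subspaces spanned by values of rational functions and orthogonal to all `Dʲv`
is zero. -/
theorem eventually_eq_bot_of_le_span (hl : l ≤ atTop)
    {s : Set (Fin 3 → RatFunc ℚ)} (hs : s.Finite)
    (h : ∀ᶠ k in l, X k ≤ Submodule.span ℚ (vec k '' s))
    (hq : ∀ i p, ∀ᶠ k in l, ∀ x ∈ X k,
      ∑ t, node k t * Polynomial.eval (node k t) p * x (i, t) = 0) :
    ∀ᶠ k in l, X k = ⊥ := by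
  obtain ⟨g, hg, hgs⟩ := exists_common_denominator hs
  -- If `g u` is a polynomial vector then so is `g² u`. The square makes the weight positive at
  -- nodes where `g` does not vanish, so it can be paired with `x` itself once `x` is in the span of
  -- the `u`.
  have hval : ∀ᶠ k in l, ∀ u ∈ s, ∀ x ∈ X k,
      ∑ i, ∑ t, node k t * (g.eval (node k t) * g.eval (node k t)) * vec k u (i, t) * x (i, t)
        = 0 := by
    rw [eventually_all_finite hs]
    intro u hu
    choose p hp using hgs u hu
    have hev : ∀ᶠ k in atTop, ∀ i t, g.eval (node k t) * ratEval (node k t) (u i) =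
        (p i).eval (node k t) := by
      rw [eventually_all]
      intro i
      refine eventually_node (p := fun q => g.eval q * ratEval q (u i) = (p i).eval q) ?_
      filter_upwards [eventually_ratEval_mul (algebraMap _ (RatFunc ℚ) g) (u i)] with m hm
      rw [hp, ratEval_algebraMap, ratEval_algebraMap] at hm
      exact hm.symm
    have hqi : ∀ᶠ k in l, ∀ i, ∀ x ∈ X k,
        ∑ t, node k t * Polynomial.eval (node k t) (g * p i) * x (i, t) = 0 :=
      eventually_all.2 fun i => hq i _
    filter_upwards [hl hev, hqi] with k hev hqi x hx
    refine Finset.sum_eq_zero fun i _ => Eq.trans (Finset.sum_congr rfl fun t _ => ?_)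
      (hqi i x hx)
    rw [Polynomial.eval_mul, ← hev i t, vec]
    ring
  filter_upwards [h, hval, hl (eventually_node (p := fun q => g.eval q ≠ 0)
    (eventually_eval_ne_zero hg))] with k h hval hne
  rw [eq_bot_iff]
  intro x hx
  set e : Fin 3 × Fin (2 ^ k) → ℚ := fun p =>
    node k p.2 * (g.eval (node k p.2) * g.eval (node k p.2)) * x p with he
  have hx0 : x ⬝ᵥ e = 0 := by
    refine dotProduct_eq_zero_of_mem_span ?_ (h hx)
    rintro _ ⟨u, hu, rfl⟩
    rw [← hval u hu x hx, dotProduct, Fintype.sum_prod_type]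
    refine Finset.sum_congr rfl fun i _ => Finset.sum_congr rfl fun t _ => ?_
    rw [he]
    ring
  have hpos : ∀ p : Fin 3 × Fin (2 ^ k),
      0 < node k p.2 * (g.eval (node k p.2) * g.eval (node k p.2)) := fun p =>
    mul_pos (node_pos k _) (mul_self_pos.2 (hne _))
  have hnn : ∀ p ∈ (Finset.univ : Finset (Fin 3 × Fin (2 ^ k))), 0 ≤ x p * e p := fun p _ => by
    have := mul_nonneg (hpos p).le (mul_self_nonneg (x p))
    rw [he]
    linarith
  rw [Submodule.mem_bot]
  ext p
  have h0 : x p * (node k p.2 * (g.eval (node k p.2) * g.eval (node k p.2)) * x p) = 0 :=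
    (Finset.sum_eq_zero_iff_of_nonneg hnn).1 hx0 p (Finset.mem_univ p)
  rcases mul_eq_zero.1 h0 with h1 | h1
  · exact h1
  · exact (mul_eq_zero.1 h1).resolve_left (hpos p).ne'

/-- A nonzero `M` is impossible, because `X k` would contain too many vectors built from
polynomials. If `M = 0`, then `X k` lies in the span of the exceptional vectors, where a positive
weight forces it to be zero. -/
theorem IsSandwiched.eventually_eq_bot (hl : l ≤ atTop) (hX : IsSandwiched l X)
    (hq : ∀ i j, ∀ᶠ k in l, ∀ x ∈ X k, (nodeForm k).form (incl i (node k ^ j)) x = 0) :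
    ∀ᶠ k in l, X k = ⊥ := by
  obtain ⟨M, s, hM, hs, h⟩ := hX
  by_cases hM0 : M = 0
  · refine eventually_eq_bot_of_le_span hl hs ?_ (eventually_sum_eval_mul_eq_zero hq)
    filter_upwards [h] with k h x hx
    obtain ⟨w, hw, hw'⟩ := h.2 x hx
    rw [hM0, act_zero] at hw'
    rwa [sub_eq_zero.1 hw'.symm]
  · filter_upwards [eventually_false_of_ne_zero hl hM hM0 hs (h.mono fun k hk => hk.1)
      (eventually_sum_pow_mul_eq_zero hq)] with k hk
    exact hk.elim

end Faithful

/-! ### Criteria for subdirect irreducibility and infinite height -/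

section Ortholattice

variable {L : Type*} [ModularOrtholattice L]

theorem ModularOrtholattice.le_compl_of_le_compl {x y : L} (h : x ≤ yᶜ) : y ≤ xᶜ := by
  have := ModularOrtholattice.compl_anti _ _ h
  rwa [ModularOrtholattice.compl_compl'] at this

/-- The orthomodular law: by modularity `y` is the join of `x` and `y ⊓ xᶜ`. -/
theorem eq_of_le_of_inf_compl_eq_bot {x y : L} (h : x ≤ y) (h' : y ⊓ xᶜ = ⊥) : x = y := by
  have := ModularOrtholattice.sup_inf_le x xᶜ y h
  rw [ModularOrtholattice.sup_compl, top_inf_eq, inf_comm, h', sup_bot_eq] at this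
  exact le_antisymm h this

/-- If `z` is congruent to `⊥` and `q` meets `zᶜ` trivially, then `q` is congruent to `⊥`. -/
theorem MOLCon.rel_bot_of_inf_compl_eq_bot (θ : MOLCon L) {q z : L} (hz : θ.r z ⊥)
    (h : q ⊓ zᶜ = ⊥) : θ.r q ⊥ := by
  have hbot : (⊥ : L)ᶜ = ⊤ := by
    simpa using ModularOrtholattice.sup_compl (⊥ : L)
  have h1 := θ.inf (θ.refl' q) (θ.compl hz)
  rw [h, hbot, inf_top_eq] at h1
  exact θ.symm' h1

/-- The congruence generated by collapsing `p`. -/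
def collapse (p : L) : MOLCon L where
  r x y := ∀ θ : MOLCon L, θ.r p ⊥ → θ.r x y
  iseqv := ⟨fun x θ _ => θ.refl' x, fun h θ hθ => θ.symm' (h θ hθ),
    fun h h' θ hθ => θ.trans' (h θ hθ) (h' θ hθ)⟩
  inf h h' θ hθ := θ.inf (h θ hθ) (h' θ hθ)
  sup h h' θ hθ := θ.sup (h θ hθ) (h' θ hθ)
  compl h θ hθ := θ.compl (h θ hθ)

/-- A criterion for subdirect irreducibility. -/
theorem isSubdirectlyIrreducibleMOL_of_inf_compl {p : L} (hp : p ≠ ⊥)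
    (h : ∀ z : L, z ≠ ⊥ → ∃ q, q ⊓ zᶜ = ⊥ ∧ p ⊓ qᶜ = ⊥) : IsSubdirectlyIrreducibleMOL L := by
  refine ⟨collapse p, ⟨p, ⊥, hp, fun θ hθ => hθ⟩, ?_⟩
  rintro θ ⟨x, y, hxy, hθ⟩ a b hab
  refine hab θ ?_
  -- Related elements are traded for a collapsed one: the complement of the meet relative to the
  -- join, nonzero because `x ≠ y`.
  have hz : θ.r ((x ⊔ y) ⊓ (x ⊓ y)ᶜ) ⊥ := by
    have h1 := θ.inf (θ.refl' (x ⊔ y)) (θ.compl (θ.r_inf_sup_iff.2 hθ))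
    rwa [ModularOrtholattice.inf_compl] at h1
  have hz0 : (x ⊔ y) ⊓ (x ⊓ y)ᶜ ≠ ⊥ := fun h0 => by
    have := eq_of_le_of_inf_compl_eq_bot (inf_le_sup : x ⊓ y ≤ x ⊔ y) h0
    exact hxy (inf_eq_sup.1 this)
  obtain ⟨q, hq, hpq⟩ := h _ hz0
  exact θ.rel_bot_of_inf_compl_eq_bot (θ.rel_bot_of_inf_compl_eq_bot hz hq) hpq

/-- The projection of `q` to `z`. -/
theorem sup_compl_inf_ne_bot {q z : L} (hq : q ≠ ⊥) (h : q ⊓ zᶜ = ⊥) : (q ⊔ zᶜ) ⊓ z ≠ ⊥ := by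
  intro h0
  have h1 : zᶜ = q ⊔ zᶜ := eq_of_le_of_inf_compl_eq_bot le_sup_right
    (by rwa [ModularOrtholattice.compl_compl'])
  have h2 : q ≤ zᶜ := h1 ▸ le_sup_left
  exact hq (by rw [← h, inf_eq_left.2 h2])

/-- A criterion for infinite height. -/
theorem latticeHeight_eq_top_of_bounded (B : L → Prop) (hbot : B ⊥) (htop : ¬ B ⊤)
    (h : ∀ z : L, z ≠ ⊥ → ∃ w ≤ z, w ≠ ⊥ ∧ ∀ b, B b → B (b ⊔ w)) : latticeHeight L = ⊤ := by
  rw [latticeHeight, iInf_eq_top]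
  rintro ⟨c, hc⟩
  suffices c.Infinite by
    simp [this.encard_eq]
  intro hfin
  -- `b` is the last element of the chain satisfying `B`, and `b'` its successor. Then `b ⊔ w` lies
  -- between them, so it belongs to the chain, and it still satisfies `B`.
  obtain ⟨b, ⟨hbc, hbB⟩, hbmax⟩ := (hfin.inter_of_left {x | B x}).exists_maximal
    ⟨⊥, hc.bot_mem, hbot⟩
  have hbtop : b < ⊤ := lt_top_iff_ne_top.2 fun h0 => htop (h0 ▸ hbB)
  obtain ⟨b', ⟨hbc', hbb'⟩, hbmin⟩ := (hfin.inter_of_left {x | b < x}).exists_minimal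
    ⟨⊤, hc.top_mem, hbtop⟩
  have hbb' : b < b' := hbb'
  obtain ⟨w, hwz, hw0, hwB⟩ := h (b' ⊓ bᶜ) fun h0 =>
    hbb'.ne (eq_of_le_of_inf_compl_eq_bot hbb'.le h0)
  have hbw : b ⊔ w ≤ b' := sup_le hbb'.le (hwz.trans inf_le_left)
  have hmem : b ⊔ w ∈ c := by
    have hchain : IsChain (· ≤ ·) (insert (b ⊔ w) c) := by
      refine hc.1.insert fun y hy _ => ?_
      by_cases hyb : y ≤ b
      · exact Or.inr (hyb.trans le_sup_left)
      · have hby : b < y := lt_of_le_not_ge ((hc.1.total hbc hy).resolve_right hyb) hyb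
        refine Or.inl (hbw.trans ?_)
        rcases hc.1.total hbc' hy with h1 | h1
        · exact h1
        · exact hbmin ⟨hy, hby⟩ h1
    rw [hc.2 hchain (Set.subset_insert _ _)]
    exact Set.mem_insert _ _
  have hle : b ⊔ w ≤ b := hbmax ⟨hmem, hwB b hbB⟩ le_sup_left
  have hwb : w ≤ b := le_sup_right.trans hle
  apply hw0
  rw [eq_bot_iff, ← ModularOrtholattice.inf_compl b]
  exact le_inf hwb (hwz.trans inf_le_right)

end Ortholattice

/-! ### Frames in products and in the subalgebra they generate -/

section Frames

theorem FrameData.isFrame_product {κ : Type*} (F : Filter κ) {L : κ → Type*}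
    [∀ k, ModularOrtholattice (L k)] {a : ∀ k, FrameData 3 (L k)} (h : ∀ k, (a k).IsFrame) :
    (FrameData.product F a).IsFrame := by
  simp only [isFrame_iff] at h ⊢
  intro i j l hij hjl hil
  refine ⟨Quotient.sound ?_, Quotient.sound ?_, Quotient.sound ?_, Quotient.sound ?_,
    Quotient.sound ?_⟩
  · exact Filter.Eventually.of_forall fun k => (h k i j l hij hjl hil).1
  · exact Filter.Eventually.of_forall fun k => (h k i j l hij hjl hil).2.1
  · exact Filter.Eventually.of_forall fun k => (h k i j l hij hjl hil).2.2.1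
  · exact Filter.Eventually.of_forall fun k => (h k i j l hij hjl hil).2.2.2.1
  · exact Filter.Eventually.of_forall fun k => (h k i j l hij hjl hil).2.2.2.2

theorem FrameData.isOrthogonal_product {κ : Type*} (F : Filter κ) {L : κ → Type*}
    [∀ k, ModularOrtholattice (L k)] {n : ℕ} {a : ∀ k, FrameData n (L k)}
    (h : ∀ k, (a k).IsOrthogonal) : (FrameData.product F a).IsOrthogonal :=
  fun i j hij => Filter.Eventually.of_forall fun k => h k i j hij

variable {L : Type*} [ModularOrtholattice L]

theorem SubMOL.subset_closure (s : Set L) : s ⊆ (SubMOL.closure s).carrier :=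
  fun _ hx _ hT => hT hx

/-- The frame `a` as a frame in the subalgebra it generates. -/
noncomputable def FrameData.inClosure {n : ℕ} (a : FrameData n L) :
    FrameData n (SubMOL.closure a.elems).Elem where
  pt i := ⟨a.pt i, SubMOL.subset_closure _ (Or.inl ⟨i, rfl⟩)⟩
  -- The diagonal entries of `a` need not lie in the closure, so they are replaced by `⊥`.
  ax i j := if h : i ≠ j then ⟨a.ax i j, SubMOL.subset_closure _ (Or.inr ⟨i, j, h, rfl⟩)⟩ else ⊥

theorem FrameData.inClosure_ax {n : ℕ} (a : FrameData n L) {i j : Fin n} (h : i ≠ j) :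
    a.inClosure.ax i j = ⟨a.ax i j, SubMOL.subset_closure _ (Or.inr ⟨i, j, h, rfl⟩)⟩ :=
  dif_pos h

theorem FrameData.isFrame_inClosure {a : FrameData 3 L} (h : a.IsFrame) :
    a.inClosure.IsFrame := by
  simp only [isFrame_iff] at h ⊢
  intro i j l hij hjl hil
  rw [inClosure_ax a hij, inClosure_ax a hil, inClosure_ax a hil.symm, inClosure_ax a hjl]
  obtain ⟨h1, h2, h3, h4, h5⟩ := h i j l hij hjl hil
  exact ⟨Subtype.ext h1, Subtype.ext h2, Subtype.ext h3, Subtype.ext h4, Subtype.ext h5⟩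

theorem FrameData.generates_inClosure {n : ℕ} (a : FrameData n L) :
    a.inClosure.Generates := by
  rintro ⟨x, hx⟩ T hT
  let T' : SubMOL L :=
    { carrier := {y | ∃ h : y ∈ (SubMOL.closure a.elems).carrier, ⟨y, h⟩ ∈ T.carrier}
      bot_mem := ⟨_, T.bot_mem⟩
      top_mem := ⟨_, T.top_mem⟩
      sup_mem := fun ⟨_, h⟩ ⟨_, h'⟩ => ⟨_, T.sup_mem h h'⟩
      inf_mem := fun ⟨_, h⟩ ⟨_, h'⟩ => ⟨_, T.inf_mem h h'⟩
      compl_mem := fun ⟨_, h⟩ => ⟨_, T.compl_mem h⟩ }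
  have hT' : a.elems ⊆ T'.carrier := by
    rintro y (⟨i, rfl⟩ | ⟨i, j, hij, rfl⟩)
    · exact ⟨SubMOL.subset_closure _ (Or.inl ⟨i, rfl⟩), hT (Or.inl ⟨i, rfl⟩)⟩
    · refine ⟨SubMOL.subset_closure _ (Or.inr ⟨i, j, hij, rfl⟩), hT (Or.inr ⟨i, j, hij, ?_⟩)⟩
      rw [inClosure_ax a hij]
  exact (hx T' hT').2

theorem FrameData.isGeneratingOrthogonalFrame_inClosure {a : FrameData 3 L} (h : a.IsFrame)
    (h' : a.IsOrthogonal) : a.inClosure.IsGeneratingOrthogonalFrame :=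
  ⟨isFrame_inClosure h, fun i j hij => h' i j hij, a.generates_inClosure⟩

end Frames

/-! ### The subalgebra of the ultraproduct generated by the frame -/

section Ultraproduct

open Filter

/-- The ultraproduct of the ortholattices of subspaces. -/
abbrev SubspaceProduct (U : Ultrafilter ℕ) : Type :=
  (U : Filter ℕ).Product fun k => SubspaceMOL (nodeForm k)

/-- The element of the ultraproduct represented by a family of subspaces. -/
def familyMk (U : Ultrafilter ℕ) (X : ∀ k, Submodule ℚ (Fin 3 × Fin (2 ^ k) → ℚ)) :
    SubspaceProduct U := Quotient.mk _ X

/-- The 3-frame in the ultraproduct. -/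
noncomputable def frameProduct (U : Ultrafilter ℕ) : FrameData 3 (SubspaceProduct U) :=
  FrameData.product (U : Filter ℕ) fun k => canonicalFrame (nodeForm k)

/-- The subalgebra of the ultraproduct generated by the 3-frame. -/
noncomputable def frameClosure (U : Ultrafilter ℕ) : SubMOL (SubspaceProduct U) :=
  SubMOL.closure (frameProduct U).elems

theorem familyMk_eq_iff (U : Ultrafilter ℕ) (X Y : ∀ k, Submodule ℚ (Fin 3 × Fin (2 ^ k) → ℚ)) :
    familyMk U X = familyMk U Y ↔ ∀ᶠ k in U, X k = Y k := Quotient.eq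

theorem frameProduct_pt (U : Ultrafilter ℕ) (i : Fin 3) :
    (frameProduct U).pt i = familyMk U fun _ => axisSub i :=
  congrArg (Quotient.mk _) (funext fun k => canonicalFrame_pt (nodeForm k) i)

theorem frameProduct_ax (U : Ultrafilter ℕ) {i j : Fin 3} (hij : i ≠ j) :
    (frameProduct U).ax i j = familyMk U fun _ => graphSub i j 1 :=
  congrArg (Quotient.mk _) (funext fun k => canonicalFrame_ax (nodeForm k) hij)

theorem isFrameFamily_frameClosure (U : Ultrafilter ℕ) :
    IsFrameFamily node node_pos {X | familyMk U X ∈ (frameClosure U).carrier} where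
  sup_mem hX hY := (frameClosure U).sup_mem hX hY
  inf_mem hX hY := (frameClosure U).inf_mem hX hY
  orthogonal_mem hX := (frameClosure U).compl_mem hX
  axisSub_mem i := by
    rw [Set.mem_ofPred_eq, ← frameProduct_pt]
    exact SubMOL.subset_closure _ (Or.inl ⟨i, rfl⟩)
  graphSub_one_mem i j hij := by
    rw [Set.mem_ofPred_eq, ← frameProduct_ax U hij]
    exact SubMOL.subset_closure _ (Or.inr ⟨i, j, hij, rfl⟩)

/-- The subalgebra of the elements that are represented by sandwiched families. -/
def sandwichedSubMOL (U : Ultrafilter ℕ) (hU : (U : Filter ℕ) ≤ atTop) :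
    SubMOL (SubspaceProduct U) :=
  have hsup : ∀ {x y : SubspaceProduct U}, (∃ X, familyMk U X = x ∧ IsSandwiched U X) →
      (∃ X, familyMk U X = y ∧ IsSandwiched U X) →
      ∃ X, familyMk U X = x ⊔ y ∧ IsSandwiched U X := by
    rintro _ _ ⟨X, rfl, hX⟩ ⟨Y, rfl, hY⟩
    exact ⟨fun k => X k ⊔ Y k, rfl, hX.sup hU hY⟩
  have hcompl : ∀ {x : SubspaceProduct U}, (∃ X, familyMk U X = x ∧ IsSandwiched U X) →
      ∃ X, familyMk U X = xᶜ ∧ IsSandwiched U X := by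
    rintro _ ⟨X, rfl, hX⟩
    exact ⟨fun k => (nodeForm k).form.orthogonal (X k), rfl, hX.orthogonal hU⟩
  have hbot : ∃ X, familyMk U X = ⊥ ∧ IsSandwiched U X := ⟨fun _ => ⊥, rfl, isSandwiched_bot _⟩
  { carrier := {x | ∃ X, familyMk U X = x ∧ IsSandwiched U X}
    bot_mem := hbot
    top_mem := by
      have h : (⊥ : SubspaceProduct U)ᶜ = ⊤ := by
        simpa using ModularOrtholattice.sup_compl (⊥ : SubspaceProduct U)
      exact h ▸ hcompl hbot
    sup_mem := hsup
    inf_mem := fun {x y} hx hy => by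
      -- De Morgan spares a direct treatment of meets of sandwiched families.
      have h : (xᶜ ⊔ yᶜ)ᶜ = x ⊓ y := by
        apply le_antisymm
        · refine le_inf ?_ ?_
          · have := ModularOrtholattice.compl_anti _ _ (le_sup_left : xᶜ ≤ xᶜ ⊔ yᶜ)
            rwa [ModularOrtholattice.compl_compl'] at this
          · have := ModularOrtholattice.compl_anti _ _ (le_sup_right : yᶜ ≤ xᶜ ⊔ yᶜ)
            rwa [ModularOrtholattice.compl_compl'] at this
        · apply ModularOrtholattice.le_compl_of_le_compl
          exact sup_le (ModularOrtholattice.compl_anti _ _ inf_le_left)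
            (ModularOrtholattice.compl_anti _ _ inf_le_right)
      exact h ▸ hcompl (hsup (hcompl hx) (hcompl hy))
    compl_mem := hcompl }

theorem exists_isSandwiched (U : Ultrafilter ℕ) (hU : (U : Filter ℕ) ≤ atTop)
    {x : SubspaceProduct U} (hx : x ∈ (frameClosure U).carrier) :
    ∃ X, familyMk U X = x ∧ IsSandwiched U X := by
  refine hx (sandwichedSubMOL U hU) ?_
  rintro _ (⟨i, rfl⟩ | ⟨i, j, hij, rfl⟩)
  · exact ⟨_, (frameProduct_pt U i).symm, isSandwiched_axisSub _ i⟩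
  · exact ⟨_, (frameProduct_ax U hij).symm, isSandwiched_graphSub_one _ hij⟩

/-- The line spanned by `Dʲv` in the `i`-th summand. -/
def powLine (i : Fin 3) (j k : ℕ) : Submodule ℚ (Fin 3 × Fin (2 ^ k) → ℚ) :=
  Submodule.span ℚ {incl i (node k ^ j)}

/-- The vector `(v, -v, -v)`. -/
def diagVec (k : ℕ) : Fin 3 × Fin (2 ^ k) → ℚ := incl 0 1 - incl 1 1 - incl 2 1

theorem diagEnd_pow_mul_onesEnd_mem (U : Ultrafilter ℕ) (j : ℕ) :
    (fun k => diagEnd (node k ^ j) * onesEnd) ∈ (isFrameFamily_frameClosure U).coordRing := by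
  have h := mul_mem (pow_mem (isFrameFamily_frameClosure U).diagEnd_mem_coordRing j)
    (isFrameFamily_frameClosure U).onesEnd_mem_coordRing
  convert h using 1
  ext1 k
  simp

theorem powLine_mem (U : Ultrafilter ℕ) (i : Fin 3) (j : ℕ) :
    familyMk U (powLine i j) ∈ (frameClosure U).carrier := by
  have h := (isFrameFamily_frameClosure U).imageSub_mem (diagEnd_pow_mul_onesEnd_mem U j) i
  have h' : ∀ k, imageSub i (diagEnd (node k ^ j) * onesEnd) = powLine i j k := fun k =>
    imageSub_eq_span_singleton (range_diagEnd_mul_onesEnd _) i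
  simp only [h'] at h
  exact h

theorem diagVec_comp (k : ℕ) : comp 0 (diagVec k) = 1 ∧ comp 1 (diagVec k) = -1 ∧
    comp 2 (diagVec k) = -1 := by
  simp [diagVec, comp_incl_of_ne]

theorem diagVec_mem (U : Ultrafilter ℕ) :
    familyMk U (fun k => Submodule.span ℚ {diagVec k}) ∈ (frameClosure U).carrier := by
  have hF := isFrameFamily_frameClosure U
  have h := hF.inf_mem (hF.inf_mem
    (hF.sup_mem (hF.graphSub_one_mem 0 1 (by decide)) (hF.axisSub_mem 2))
    (hF.sup_mem (hF.graphSub_one_mem 0 2 (by decide)) (hF.axisSub_mem 1)))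
    (hF.sup_mem (hF.imageSub_mem (diagEnd_pow_mul_onesEnd_mem U 0) 0)
      (hF.sup_mem (hF.axisSub_mem 1) (hF.axisSub_mem 2)))
  have h' : ∀ k, (graphSub 0 1 1 ⊔ axisSub 2) ⊓ (graphSub 0 2 1 ⊔ axisSub 1) ⊓
      (imageSub 0 (diagEnd (node k ^ 0) * onesEnd) ⊔ (axisSub 1 ⊔ axisSub 2)) =
      Submodule.span ℚ {diagVec k} := by
    intro k
    obtain ⟨h0, h1, h2⟩ := diagVec_comp k
    refine span_singleton_eq_of_comp (by rw [h0, h1]; rfl) (by rw [h0, h2]; rfl) ?_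
    rw [range_diagEnd_mul_onesEnd, h0, pow_zero]
  simp only [h'] at h
  exact h

theorem span_singleton_inf_orthogonal {ι : Type*} (Φ : PosDefForm ι) {a y : ι → ℚ}
    {Y : Submodule ℚ (ι → ℚ)} (hy : y ∈ Y) (h : Φ.form y a ≠ 0) :
    Submodule.span ℚ {a} ⊓ Φ.form.orthogonal Y = ⊥ := by
  rw [eq_bot_iff]
  rintro x ⟨hx, hx'⟩
  obtain ⟨c, rfl⟩ := Submodule.mem_span_singleton.1 hx
  have h0 : Φ.form y (c • a) = 0 := hx' y hy
  rw [map_smul, smul_eq_mul] at h0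
  rw [(mul_eq_zero.1 h0).resolve_right h, zero_smul]
  exact zero_mem _

/-- Up to sign, the pairing of `diagVec` with each `Dʲv` is a sum of positive terms. So this one
line is non-orthogonal to all of them and can serve as the generator of the least congruence. -/
theorem diagVec_inf_orthogonal_powLine (i : Fin 3) (j k : ℕ) :
    Submodule.span ℚ {diagVec k} ⊓ (nodeForm k).form.orthogonal (powLine i j k) = ⊥ := by
  refine span_singleton_inf_orthogonal _ (Submodule.mem_span_singleton_self _) ?_
  have hpos : ∀ m, 0 < ∑ t, node k t ^ m := fun m =>
    Finset.sum_pos (fun t _ => pow_pos (node_pos k t) m) ⟨0, Finset.mem_univ _⟩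
  rw [nodeForm, blockForm_incl_left]
  obtain ⟨h0, h1, h2⟩ := diagVec_comp k
  fin_cases i
  · change (node k ^ j) ⬝ᵥ comp 0 (diagVec k) ≠ 0
    rw [h0, dotProduct_one]
    exact (hpos j).ne'
  · change (node k ^ j) ⬝ᵥ (node k * comp 1 (diagVec k)) ≠ 0
    rw [h1, mul_neg, mul_one, dotProduct_neg, neg_ne_zero]
    refine ne_of_gt (lt_of_lt_of_eq (hpos (j + 1)) ?_)
    simp [dotProduct, pow_succ]
  · change (node k ^ j) ⬝ᵥ (comp 2 (diagVec k) + onesEnd (comp 2 (diagVec k))) ≠ 0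
    rw [h2, map_neg, ← neg_add, dotProduct_neg, neg_ne_zero, dotProduct_add, dotProduct_onesEnd,
      dotProduct_one]
    refine ne_of_gt (add_pos (hpos j) (mul_pos (hpos j) ?_))
    simp

/-- A nonzero element of the generated subalgebra is not orthogonal to all lines `powLine i j`. -/
theorem exists_powLine_inf_compl (U : Ultrafilter ℕ) (hU : (U : Filter ℕ) ≤ atTop)
    {z : SubspaceProduct U} (hz : z ∈ (frameClosure U).carrier) (hz0 : z ≠ ⊥) :
    ∃ i j, familyMk U (powLine i j) ⊓ zᶜ = ⊥ := by
  obtain ⟨X, rfl, hX⟩ := exists_isSandwiched U hU hz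
  by_contra! hcon
  apply hz0
  refine (familyMk_eq_iff U _ fun _ => ⊥).2 (hX.eventually_eq_bot hU fun i j => ?_)
  -- The ultrafilter turns failure of equality in the quotient into failure in almost every factor.
  -- For a line, meeting the orthogonal nontrivially means lying in it.
  have h : ∀ᶠ k in U, ¬ powLine i j k ⊓ (nodeForm k).form.orthogonal (X k) = ⊥ :=
    Ultrafilter.eventually_not.2 fun h => hcon i j
      ((familyMk_eq_iff U (fun k => powLine i j k ⊓ (nodeForm k).form.orthogonal (X k))
        fun _ => ⊥).2 h)
  filter_upwards [h] with k hk x hx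
  by_contra hne
  exact hk (span_singleton_inf_orthogonal _ hx (by rwa [(nodeForm k).symm]))

theorem familyMk_powLine_ne_bot (U : Ultrafilter ℕ) (i : Fin 3) (j : ℕ) :
    familyMk U (powLine i j) ≠ ⊥ := by
  intro h
  obtain ⟨k, hk⟩ := ((familyMk_eq_iff U _ fun _ => ⊥).1 h).exists
  have h0 : incl i (node k ^ j) = 0 := by
    rw [← Submodule.mem_bot ℚ, ← hk]
    exact Submodule.mem_span_singleton_self _
  have h1 := congrArg (comp i) h0
  rw [comp_incl_self, map_zero] at h1
  exact (pow_pos (node_pos k 0) j).ne' (congrFun h1 0)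

theorem isSubdirectlyIrreducible_frameClosure (U : Ultrafilter ℕ)
    (hU : (U : Filter ℕ) ≤ atTop) : IsSubdirectlyIrreducibleMOL (frameClosure U).Elem := by
  refine isSubdirectlyIrreducibleMOL_of_inf_compl (p := ⟨_, diagVec_mem U⟩) ?_ ?_
  · intro h
    obtain ⟨k, hk⟩ := ((familyMk_eq_iff U _ fun _ => ⊥).1 (congrArg Subtype.val h)).exists
    have h0 : diagVec k = 0 := by
      rw [← Submodule.mem_bot ℚ, ← hk]
      exact Submodule.mem_span_singleton_self _
    have h1 := (diagVec_comp k).1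
    rw [h0, map_zero] at h1
    exact zero_ne_one (congrFun h1 0)
  · rintro ⟨z, hz⟩ hz0
    obtain ⟨i, j, h⟩ := exists_powLine_inf_compl U hU hz fun h => hz0 (Subtype.ext h)
    refine ⟨⟨_, powLine_mem U i j⟩, Subtype.ext h, Subtype.ext ?_⟩
    exact (familyMk_eq_iff U (fun k => Submodule.span ℚ {diagVec k} ⊓
      (nodeForm k).form.orthogonal (powLine i j k)) fun _ => ⊥).2
      (Eventually.of_forall fun k => diagVec_inf_orthogonal_powLine i j k)

/-- Projections of lines have dimension at most one. -/
theorem finrank_span_sup_orthogonal_inf_le {ι : Type*} [Finite ι] (Φ : PosDefForm ι) (a : ι → ℚ)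
    (Z : Submodule ℚ (ι → ℚ)) :
    Module.finrank ℚ ((Submodule.span ℚ {a} ⊔ Φ.form.orthogonal Z) ⊓ Z :
      Submodule ℚ (ι → ℚ)) ≤ 1 := by
  set W := (Submodule.span ℚ {a} ⊔ Φ.form.orthogonal Z) ⊓ Z
  have h1 : W ⊓ Φ.form.orthogonal Z = ⊥ := by
    rw [eq_bot_iff, ← Φ.inf_orthogonal Z]
    exact inf_le_inf_right _ inf_le_right
  have h2 := Submodule.finrank_sup_add_finrank_inf_eq W (Φ.form.orthogonal Z)
  have h3 : W ⊔ Φ.form.orthogonal Z ≤ Submodule.span ℚ {a} ⊔ Φ.form.orthogonal Z :=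
    sup_le inf_le_left le_sup_right
  have h4 := Submodule.finrank_mono h3
  have h5 := Submodule.finrank_add_le_finrank_add_finrank (Submodule.span ℚ {a})
    (Φ.form.orthogonal Z)
  have h6 : Module.finrank ℚ (Submodule.span ℚ {a}) ≤ 1 := by
    simpa using finrank_span_le_card (R := ℚ) ({a} : Set (ι → ℚ))
  rw [h1, finrank_bot] at h2
  omega

/-- Boundedness means being represented by subspaces whose dimensions are bounded almost everywhere.
The projection of a line `powLine i j` to `z` raises the bound by at most one. -/
theorem latticeHeight_frameClosure (U : Ultrafilter ℕ) (hU : (U : Filter ℕ) ≤ atTop) :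
    latticeHeight (frameClosure U).Elem = ⊤ := by
  refine latticeHeight_eq_top_of_bounded
    (fun x => ∃ (N : ℕ) (X : ∀ k, Submodule ℚ (Fin 3 × Fin (2 ^ k) → ℚ)),
      familyMk U X = x.1 ∧ ∀ᶠ k in U, Module.finrank ℚ (X k) ≤ N) ?_ ?_ ?_
  · exact ⟨0, fun _ => ⊥, rfl, Eventually.of_forall fun k => (finrank_bot ℚ _).le⟩
  · rintro ⟨N, X, hX, hN⟩
    obtain ⟨k, ⟨hk, hkN⟩, hle⟩ := ((((familyMk_eq_iff U X fun _ => ⊤).1 hX).and hN).and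
      (hU (eventually_ge_atTop N))).exists
    rw [hk, finrank_top, Module.finrank_fintype_fun_eq_card, Fintype.card_prod,
      Fintype.card_fin, Fintype.card_fin] at hkN
    have : k < 2 ^ k := Nat.lt_two_pow_self
    omega
  · rintro ⟨z, hz⟩ hz0
    obtain ⟨i, j, h⟩ := exists_powLine_inf_compl U hU hz fun h => hz0 (Subtype.ext h)
    refine ⟨⟨(familyMk U (powLine i j) ⊔ zᶜ) ⊓ z, (frameClosure U).inf_mem
      ((frameClosure U).sup_mem (powLine_mem U i j) ((frameClosure U).compl_mem hz)) hz⟩,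
      (inf_le_right : (familyMk U (powLine i j) ⊔ zᶜ) ⊓ z ≤ z), fun h0 => ?_, ?_⟩
    · exact sup_compl_inf_ne_bot (familyMk_powLine_ne_bot U i j) h (congrArg Subtype.val h0)
    · obtain ⟨Z, rfl, -⟩ := exists_isSandwiched U hU hz
      rintro ⟨_, hb⟩ ⟨N, X, rfl, hN⟩
      refine ⟨N + 1, fun k => X k ⊔ (powLine i j k ⊔ (nodeForm k).form.orthogonal (Z k)) ⊓ Z k,
        rfl, ?_⟩
      filter_upwards [hN] with k hk
      exact (Submodule.finrank_add_le_finrank_add_finrank _ _).trans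
        (add_le_add hk (finrank_span_sup_orthogonal_inf_le _ _ _))

end Ultraproduct

theorem corollary4p16 :
    ∃ Φ : ∀ k : ℕ, PosDefForm (Fin 3 × Fin (2 ^ k)),
      (∀ k : ℕ, (canonicalFrame (Φ k)).IsGeneratingOrthogonalFrame) ∧
      ∀ U : Ultrafilter ℕ, (∀ k : ℕ, U ≠ pure k) →
        ∃ S : SubMOL ((U : Filter ℕ).Product fun k => SubspaceMOL (Φ k)),
          IsSubdirectlyIrreducibleMOL S.Elem ∧
          latticeHeight S.Elem = ⊤ ∧
          ∃ a : FrameData 3 S.Elem,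
            a.IsGeneratingOrthogonalFrame ∧
            (∀ i, (a.pt i).1 =
              (FrameData.product (U : Filter ℕ) fun k => canonicalFrame (Φ k)).pt i) ∧
            (∀ i j, i ≠ j → (a.ax i j).1 =
              (FrameData.product (U : Filter ℕ) fun k => canonicalFrame (Φ k)).ax i j) := by
  have hframe : ∀ k, (canonicalFrame (nodeForm k)).IsGeneratingOrthogonalFrame := fun k =>
    isGeneratingOrthogonalFrame_canonicalFrame (node_pos k) (node_injective k)
  refine ⟨nodeForm, hframe, fun U hU => ?_⟩
  -- A non-principal ultrafilter refines the cofinite filter, so whatever holds for all large `k`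
  -- holds almost everywhere.
  have hU' : (U : Filter ℕ) ≤ Filter.atTop := by
    rw [← Nat.cofinite_eq_atTop]
    exact U.le_cofinite_or_eq_pure.resolve_right fun ⟨k, hk⟩ => hU k hk
  refine ⟨frameClosure U, isSubdirectlyIrreducible_frameClosure U hU',
    latticeHeight_frameClosure U hU', (frameProduct U).inClosure,
    FrameData.isGeneratingOrthogonalFrame_inClosure
      (FrameData.isFrame_product _ fun k => (hframe k).1)
      (FrameData.isOrthogonal_product _ fun k => (hframe k).2.1), fun i => rfl, fun i j hij => ?_⟩
  rw [FrameData.inClosure_ax _ hij]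
  rfl
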